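/- Let $G$ be a Lie group of dimension $n\ge 3$ with Lie algebra $\mathfrak g$ such that every left-invariant Riemannian metric on $G$ has non-positive scalar curvature. Let $J\subset\mathbb R$ be an interval with non-empty interior, $C,V\in C^1(J)$, $c\in C^0(J)$, and let $I=[t_0,\infty)$. Let $\gamma\in C^2(I)$ be a family of (left-invariant) Riemannian metrics on $\mathfrak g$, $\phi\in C^2(I,J)$, and let $\rho$ be a function, $j$ a covector on $\mathfrak g$ and $S$ a symmetric covariant $2$-tensor on $\mathfrak g$, all depending $C^1$ on $t\in I$. On $M=G\times I$, with projections $\pi,t$, put $g=\pi^*\gamma-dt\otimes dt$ and $T=\pi^*S-\pi^*j\otimes dt-dt\otimes\pi^*j+\rho\,dt\otimes dt$, and suppose that the coupled Einstein–scalar field–matter equations hold on $M$: $$Rc_g-\tfrac12R_g\,g=\nabla\phi\otimes\nabla\phi-\tfrac12|\nabla\phi|_g^2\,g-V(\phi)g+C(\phi)T,$$ $$\Box_g\phi-V'(\phi)=-c(\phi)\operatorname{tr}_gT,\qquad \operatorname{Div}_g\big(C(\phi)T\big)=c(\phi)(\operatorname{tr}_gT)\nabla\phi .$$ Write $k=-\tfrac12\dot\gamma$,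 $H=-\tfrac1n\operatorname{tr}_\gamma k$, $\sigma=k+H\gamma$, and let $R_\gamma$ be the scalar curvature of $\gamma(t)$ on $G$. Assume: * energy conditions: $|j|_\gamma\le\rho$, $|\operatorname{tr}_\gamma S|\le n\rho$ and $\rho+\operatorname{tr}_\gamma S\ge0$ on $I$; * $C\ge0$, and $|c|\le C_0C$ on $J$ for some constant $C_0$; * $V>0$ on $J$, and: (P1) there is a positive lower semicontinuous function $\bar V$ on the closure $\bar J$ of $J$ in $\mathbb R$ with $V\ge\bar V$ on $J$; (P2) $V'$ is bounded on every subset of $J$ on which $V$ is bounded; (P3) $V'$ extends to a continuous function with values in $[-\infty,\infty]$ on the closure of $J$ in $[-\infty,\infty]$; * $H(t_0)>0$; * if $V_0:=\inf_{t\in I}V(\phi(t))$ equals $0$, then $\phi(t)$ does not tend to $-\infty$ as $t\to\infty$ (a normalization, which can be achieved by replacing $\phi$ by $-\phi$); * the potential is flat at infinity: $V'(x)/V(x)\to0$ as $x\to\infty$, $x\in J$ (no condition if $J$ is bounded above). Then $H>0$ on $I$, and as $t\to\infty$ $$\frac{\dot\phi}{H},\quad\frac{|\sigma|_\gamma^2}{H^2},\quad\frac{R_\gamma}{H^2},\quad\frac{C(\phi)\rho}{H^2},\quad\frac{C(\phi)|j|_\gamma}{H^2},\quad\frac{C(\phi)\operatorname{tr}_\gamma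 S}{H^2},\quad\frac{c(\phi)\operatorname{tr}_gT}{H^2}\ \longrightarrow\ 0 .$$ -/

import Mathlib

open Set Filter Topology
open scoped Manifold ContDiff

namespace CoupledQuintessence

noncomputable section

/-! ### Left-invariant tensor calculus

Let `L` be the Lie algebra of left-invariant vector fields of a Lie group and `τ` a linear form on
`L`. Left-invariant tensor fields whose components depend on one parameter `t ∈ I` are described by
their values on `L`, and a left-invariant vector field `X` acts on a function `f` of `t` as
`X f = τ X * f'`. Two cases are used:

* `L = 𝔤` and `τ = 0`: left-invariant geometry on the Lie group `G` itself;
* `L = 𝔤 × ℝ` and `τ = dt`, the second projection: geometry of `M = G × I`, where `(x, a)` is the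
  vector field `x + a ∂_t` with `x` left-invariant and `a` constant. These fields span every
  tangent space of `M`, and the commutator of `x + a ∂_t` and `y + b ∂_t` is `[x, y]`.

All formulas below are the coordinate-free definitions of semi-Riemannian geometry (Koszul formula,
`R(X,Y)Z = ∇_X ∇_Y Z - ∇_Y ∇_X Z - ∇_[X,Y] Z`, and so on) evaluated on such fields. -/

section Calculus

variable {L : Type*} [AddCommGroup L] [Module ℝ L] [FiniteDimensional ℝ L]

/-- A basis `(e_i)` of `L`; contractions do not depend on this choice. -/
def frame (L : Type*) [AddCommGroup L] [Module ℝ L] [FiniteDimensional ℝ L] :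
    Module.Basis (Fin (Module.finrank ℝ L)) ℝ L :=
  Module.finBasis ℝ L

open Classical in
/-- The `h`-dual basis `(e^i)`, with `h (e^i, e_j) = δ^i_j` (zero if `h` is degenerate). -/
def dualFrame (h : LinearMap.BilinForm ℝ L) (i : Fin (Module.finrank ℝ L)) : L :=
  if hh : h.Nondegenerate then h.dualBasis hh (frame L) i else 0

/-- The trace `tr_h A = A_{ij} h^{ij}` of a covariant 2-tensor. -/
def metricTrace (h : LinearMap.BilinForm ℝ L) (A : L → L → ℝ) : ℝ :=
  ∑ i, A (frame L i) (dualFrame h i)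

/-- The fibre metric `⟨A, B⟩_h = A_{ij} B^{ij}` on covariant 2-tensors. -/
def tensorInner (h : LinearMap.BilinForm ℝ L) (A B : L → L → ℝ) : ℝ :=
  ∑ i, ∑ k, A (frame L i) (frame L k) * B (dualFrame h i) (dualFrame h k)

/-- The squared length `|α|²_h = α_i α^i` of a covector. -/
def covectorSq (h : LinearMap.BilinForm ℝ L) (α : L → ℝ) : ℝ :=
  ∑ i, α (frame L i) * α (dualFrame h i)

/-- The derivative at time `t ∈ I` of a function `f` of `t` along the field `X`. -/
def alongField (I : Set ℝ) (τ : L →ₗ[ℝ] ℝ) (X : L) (f : ℝ → ℝ) (t : ℝ) : ℝ :=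
  τ X * derivWithin f I t

/-- `h` is the value on the Lie algebra of a left-invariant Riemannian metric. -/
structure IsRiemannian (h : LinearMap.BilinForm ℝ L) : Prop where
  symm : ∀ x y, h x y = h y x
  pos : ∀ x, x ≠ 0 → 0 < h x x

variable [Bracket L L]

/-- Koszul formula: the value of `g (∇_X Y, Z)` for the Levi-Civita connection of `g`. -/
def koszul (I : Set ℝ) (τ : L →ₗ[ℝ] ℝ) (g : ℝ → LinearMap.BilinForm ℝ L) (X Y Z : L)
    (t : ℝ) : ℝ :=
  (alongField I τ X (fun s => g s Y Z) t + alongField I τ Y (fun s => g s X Z) t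
    - alongField I τ Z (fun s => g s X Y) t
    + g t ⁅X, Y⁆ Z - g t ⁅X, Z⁆ Y - g t ⁅Y, Z⁆ X) / 2

/-- The Levi-Civita connection: the vector `∇_X Y` at time `t`. -/
def nabla (I : Set ℝ) (τ : L →ₗ[ℝ] ℝ) (g : ℝ → LinearMap.BilinForm ℝ L) (X Y : L)
    (t : ℝ) : L :=
  ∑ i, koszul I τ g X Y (frame L i) t • dualFrame (g t) i

/-- The curvature `g (R(X,Y)Z, W)`. The term `g (∇_X ∇_Y Z, W)` is written, by compatibility
of `∇` with `g`, as `X (g (∇_Y Z, W)) - g (∇_Y Z, ∇_X W)`. -/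
def riemann (I : Set ℝ) (τ : L →ₗ[ℝ] ℝ) (g : ℝ → LinearMap.BilinForm ℝ L) (X Y Z W : L)
    (t : ℝ) : ℝ :=
  (alongField I τ X (koszul I τ g Y Z W) t - g t (nabla I τ g Y Z t) (nabla I τ g X W t))
    - (alongField I τ Y (koszul I τ g X Z W) t - g t (nabla I τ g X Z t) (nabla I τ g Y W t))
    - koszul I τ g ⁅X, Y⁆ Z W t

/-- The Ricci tensor `Rc(Y,Z) = tr (X ↦ R(X,Y)Z)`. -/
def ricci (I : Set ℝ) (τ : L →ₗ[ℝ] ℝ) (g : ℝ → LinearMap.BilinForm ℝ L) (Y Z : L)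
    (t : ℝ) : ℝ :=
  metricTrace (g t) (fun X W => riemann I τ g X Y Z W t)

/-- The scalar curvature. -/
def scalarCurv (I : Set ℝ) (τ : L →ₗ[ℝ] ℝ) (g : ℝ → LinearMap.BilinForm ℝ L) (t : ℝ) : ℝ :=
  metricTrace (g t) (fun Y Z => ricci I τ g Y Z t)

/-- The covariant derivative `(∇_X A)(Y, Z)` of a covariant 2-tensor. -/
def covDeriv (I : Set ℝ) (τ : L →ₗ[ℝ] ℝ) (g A : ℝ → LinearMap.BilinForm ℝ L) (X Y Z : L)
    (t : ℝ) : ℝ :=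
  alongField I τ X (fun s => A s Y Z) t - A t (nabla I τ g X Y t) Z - A t Y (nabla I τ g X Z t)

/-- The divergence `(Div_g A)(Z) = ∇^a A_{ab} Z^b` of a covariant 2-tensor. -/
def divergence (I : Set ℝ) (τ : L →ₗ[ℝ] ℝ) (g A : ℝ → LinearMap.BilinForm ℝ L) (Z : L)
    (t : ℝ) : ℝ :=
  metricTrace (g t) (fun X Y => covDeriv I τ g A X Y Z t)

/-- The Hessian `(∇²f)(X, Y) = X (Y f) - (∇_X Y) f` of a function of `t`. -/
def hessian (I : Set ℝ) (τ : L →ₗ[ℝ] ℝ) (g : ℝ → LinearMap.BilinForm ℝ L) (f : ℝ → ℝ) (X Y : L)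
    (t : ℝ) : ℝ :=
  alongField I τ X (alongField I τ Y f) t - alongField I τ (nabla I τ g X Y t) f t

/-- The covariant wave (or Laplace) operator `□_g f = tr_g ∇²f`. -/
def box (I : Set ℝ) (τ : L →ₗ[ℝ] ℝ) (g : ℝ → LinearMap.BilinForm ℝ L) (f : ℝ → ℝ)
    (t : ℝ) : ℝ :=
  metricTrace (g t) (fun X Y => hessian I τ g f X Y t)

/-- The scalar curvature `R_h` of a left-invariant Riemannian metric `h` on the group. -/
def groupScalarCurv (h : LinearMap.BilinForm ℝ L) : ℝ :=
  scalarCurv univ 0 (fun _ => h) 0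

end Calculus

/-! ### The coupled quintessence model -/

/-- The commutator of the vector fields `x + a ∂_t` on `G × I`: the bracket of the product of the
Lie algebra `𝔤` with the abelian Lie algebra `ℝ ∂_t`. -/
instance instBracketSpacetime {𝔤 : Type*} [LieRing 𝔤] : Bracket (𝔤 × ℝ) (𝔤 × ℝ) where
  bracket X Y := (⁅X.1, Y.1⁆, 0)

/-- The fields of a spatially homogeneous coupled quintessence model on `G × [t₀, ∞)`, where `𝔤` is
the Lie algebra of `G`: coupling functions `C`, `c` and potential `V` on the interval `J`, spatial
metric `γ`, scalar field `φ` with values in `J`, and energy density `ρ`, flow covector `j` and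
pressure tensor `S` of the ordinary matter. No field equation is imposed here. -/
structure Model (𝔤 : Type*) [LieRing 𝔤] [LieAlgebra ℝ 𝔤] [FiniteDimensional ℝ 𝔤] where
  J : Set ℝ
  J_interval : J.OrdConnected
  J_interior : (interior J).Nonempty
  C : ℝ → ℝ
  C_contDiff : ContDiffOn ℝ 1 C J
  c : ℝ → ℝ
  c_continuous : ContinuousOn c J
  V : ℝ → ℝ
  V_contDiff : ContDiffOn ℝ 1 V J
  t₀ : ℝ
  γ : ℝ → LinearMap.BilinForm ℝ 𝔤
  γ_contDiff : ∀ x y, ContDiffOn ℝ 2 (fun t => γ t x y) (Ici t₀)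
  γ_riemannian : ∀ t ∈ Ici t₀, IsRiemannian (γ t)
  φ : ℝ → ℝ
  φ_contDiff : ContDiffOn ℝ 2 φ (Ici t₀)
  φ_mem : ∀ t ∈ Ici t₀, φ t ∈ J
  ρ : ℝ → ℝ
  ρ_contDiff : ContDiffOn ℝ 1 ρ (Ici t₀)
  j : ℝ → Module.Dual ℝ 𝔤
  j_contDiff : ∀ x, ContDiffOn ℝ 1 (fun t => j t x) (Ici t₀)
  S : ℝ → LinearMap.BilinForm ℝ 𝔤
  S_contDiff : ∀ x y, ContDiffOn ℝ 1 (fun t => S t x y) (Ici t₀)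
  S_symm : ∀ t ∈ Ici t₀, ∀ x y, S t x y = S t y x

namespace Model

variable {𝔤 : Type*} [LieRing 𝔤] [LieAlgebra ℝ 𝔤] [FiniteDimensional ℝ 𝔤] (M : Model 𝔤)

/-- The time interval. -/
def I : Set ℝ := Ici M.t₀

/-- The derivative of the potential (one-sided at an end of `J` that belongs to `J`). -/
def V' : ℝ → ℝ := derivWithin M.V M.J

/-- The time derivative of the scalar field. -/
def φdot : ℝ → ℝ := derivWithin M.φ M.I

/-- The dimension of the group, as a real number. -/
def dim (_M : Model 𝔤) : ℝ := (Module.finrank ℝ 𝔤 : ℝ)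

/-- The tensor `k = - γ̇ / 2`. -/
def k (t : ℝ) (x y : 𝔤) : ℝ := -(1 / 2) * derivWithin (fun s => M.γ s x y) M.I t

/-- The expansion `H = - tr_γ k / n`. -/
def H (t : ℝ) : ℝ := -metricTrace (M.γ t) (M.k t) / M.dim

/-- The shear `σ = k + H γ`. -/
def σ (t : ℝ) (x y : 𝔤) : ℝ := M.k t x y + M.H t * M.γ t x y

/-- `|σ|²_γ`. -/
def shearSq (t : ℝ) : ℝ := tensorInner (M.γ t) (M.σ t) (M.σ t)

/-- The scalar curvature `R_γ` of the spatial metric. -/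
def spatialCurv (t : ℝ) : ℝ := groupScalarCurv (M.γ t)

/-- `|j|_γ`. -/
def jNorm (t : ℝ) : ℝ := Real.sqrt (covectorSq (M.γ t) (M.j t))

/-- `tr_γ S`. -/
def trS (t : ℝ) : ℝ := metricTrace (M.γ t) (fun x y => M.S t x y)

/-- The one-form `dt` on the space-time. -/
def dt (𝔤 : Type*) [LieRing 𝔤] [LieAlgebra ℝ 𝔤] : 𝔤 × ℝ →ₗ[ℝ] ℝ := LinearMap.snd ℝ 𝔤 ℝ

/-- The Lorentzian metric `g = π^* γ - dt ⊗ dt`. -/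
def g (t : ℝ) : LinearMap.BilinForm ℝ (𝔤 × ℝ) :=
  (M.γ t).comp (LinearMap.fst ℝ 𝔤 ℝ) (LinearMap.fst ℝ 𝔤 ℝ)
    - LinearMap.BilinForm.linMulLin (dt 𝔤) (dt 𝔤)

theorem g_apply (t : ℝ) (X Y : 𝔤 × ℝ) : M.g t X Y = M.γ t X.1 Y.1 - X.2 * Y.2 := by
  simp [g, dt]

/-- The matter tensor `T = π^* S - π^* j ⊗ dt - dt ⊗ π^* j + ρ dt ⊗ dt`. -/
def T (t : ℝ) : LinearMap.BilinForm ℝ (𝔤 × ℝ) :=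
  (M.S t).comp (LinearMap.fst ℝ 𝔤 ℝ) (LinearMap.fst ℝ 𝔤 ℝ)
    - LinearMap.BilinForm.linMulLin (M.j t ∘ₗ LinearMap.fst ℝ 𝔤 ℝ) (dt 𝔤)
    - LinearMap.BilinForm.linMulLin (dt 𝔤) (M.j t ∘ₗ LinearMap.fst ℝ 𝔤 ℝ)
    + M.ρ t • LinearMap.BilinForm.linMulLin (dt 𝔤) (dt 𝔤)

theorem T_apply (t : ℝ) (X Y : 𝔤 × ℝ) :
    M.T t X Y = M.S t X.1 Y.1 - M.j t X.1 * Y.2 - X.2 * M.j t Y.1 + M.ρ t * (X.2 * Y.2) := by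
  simp [T, dt]

/-- `tr_g T`. -/
def trT (t : ℝ) : ℝ := metricTrace (M.g t) (fun X Y => M.T t X Y)

/-- The differential `∇_g φ`, as a one-form on the space-time. -/
def dφ (t : ℝ) (X : 𝔤 × ℝ) : ℝ := alongField M.I (dt 𝔤) X M.φ t

/-- The coupled Einstein-scalar-field-matter equations on `G × I`. -/
structure SolvesESM : Prop where
  einstein : ∀ t ∈ M.I, ∀ X Y : 𝔤 × ℝ,
    ricci M.I (dt 𝔤) M.g X Y t - 1 / 2 * scalarCurv M.I (dt 𝔤) M.g t * M.g t X Y =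
      M.dφ t X * M.dφ t Y - 1 / 2 * covectorSq (M.g t) (M.dφ t) * M.g t X Y
        - M.V (M.φ t) * M.g t X Y + M.C (M.φ t) * M.T t X Y
  scalar : ∀ t ∈ M.I,
    box M.I (dt 𝔤) M.g M.φ t - M.V' (M.φ t) = -M.c (M.φ t) * M.trT t
  matter : ∀ t ∈ M.I, ∀ Z : 𝔤 × ℝ,
    divergence M.I (dt 𝔤) M.g (fun s => M.C (M.φ s) • M.T s) Z t =
      M.c (M.φ t) * M.trT t * M.dφ t Z

/-- The energy conditions imposed on the ordinary matter. -/
structure EnergyConditions : Prop where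
  dec_flow : ∀ t ∈ M.I, M.jNorm t ≤ M.ρ t
  dec_pressure : ∀ t ∈ M.I, |M.trS t| ≤ M.dim * M.ρ t
  sec : ∀ t ∈ M.I, 0 ≤ M.ρ t + M.trS t

/-- The assumptions on the coupling functions. -/
structure CouplingConditions : Prop where
  nonneg : ∀ x ∈ M.J, 0 ≤ M.C x
  bound : ∃ C₀ : ℝ, ∀ x ∈ M.J, |M.c x| ≤ C₀ * M.C x

/-- The assumptions on the potential. -/
structure PotentialConditions : Prop where
  pos : ∀ x ∈ M.J, 0 < M.V x
  minorant : ∃ Vbar : ℝ → ℝ, LowerSemicontinuousOn Vbar (closure M.J) ∧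
    (∀ x ∈ closure M.J, 0 < Vbar x) ∧ ∀ x ∈ M.J, Vbar x ≤ M.V x
  deriv_bounded : ∀ A ⊆ M.J, Bornology.IsBounded (M.V '' A) → Bornology.IsBounded (M.V' '' A)
  deriv_extends : ∃ F : EReal → EReal,
    ContinuousOn F (closure ((fun x : ℝ => (x : EReal)) '' M.J)) ∧
      ∀ x ∈ M.J, F (x : EReal) = ((M.V' x : ℝ) : EReal)

/-- The infimum `V₀` of the potential energy density along the evolution. -/
def V₀ : ℝ := sInf ((fun t => M.V (M.φ t)) '' M.I)

/-- The potential is flat at infinity: `V'/V → 0` as `x → ∞` in `J`. -/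
def FlatAtInfinity : Prop :=
  Tendsto (fun x => M.V' x / M.V x) (atTop ⊓ 𝓟 M.J) (𝓝 0)

end Model

instance instFiniteDimensionalGroupLieAlgebra {n : ℕ} {G : Type*} [TopologicalSpace G]
    [ChartedSpace (EuclideanSpace ℝ (Fin n)) G] [Group G] [LieGroup (𝓡 n) (minSmoothness ℝ 3) G] :
    FiniteDimensional ℝ (GroupLieAlgebra (𝓡 n) G) :=
  inferInstanceAs (FiniteDimensional ℝ (EuclideanSpace ℝ (Fin n)))

end

end CoupledQuintessence

/-! Write n for the dimension of G. The field equations yield three scalar relations: the constraint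
n(n-1)H² + R_γ = |σ|² + φ̇² + 2V + 2Cρ, the Raychaudhuri equation for Ḣ, and the equation for φ̈.
`ReducedSystem` collects them; the rest is ODE analysis. Let Z = n(n-1)H² - φ̇² - 2V = |σ|² - R_γ +
2Cρ. Since R_γ ≤ 0, Z is a sum of nonnegative terms, and the energy and coupling conditions bound
every other quantity of the claim by a multiple of Z. So φ̇/H → 0 and Z/H² → 0 suffice.

As V > 0, the constraint forbids H = 0. Hence H stays positive; it decreases, so it has a limit L ≥
0.

If L > 0 (`tendsto_of_pos_limit`), V is bounded by the constraint, V' by (P2), hence φ̈ is bounded;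
since φ̇² ≤ -n(n-1)Ḣ, a Barbalat argument gives φ̇ → 0. In Ż the terms with V' and φ̇² cancel, and
the coupling term is absorbed once φ̇ is small, so Ż ≤ -LZ.

If L = 0 (`tendsto_of_zero_limit`), then V → 0, (P1) forces |φ| → ∞, the normalization selects +∞,
and flatness gives V'/V → 0. While (Z + φ̇²)/H² ≥ δ, the ratio V/H² grows at a rate at least
proportional to H. As Ḣ ≥ -nH² and H → 0, the integral of H diverges, so this cannot last; once (Z +
φ̇²)/H² is below δ, the same growth traps it there. -/

namespace CoupledQuintessence

/-! ### Contractions with a nondegenerate form, and their splitting on `L × ℝ`. -/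

section LinearAlgebra

variable {L : Type*} [AddCommGroup L] [Module ℝ L]

/-- A function of two vectors is bilinear. -/
def IsBilin (A : L → L → ℝ) : Prop :=
  ∃ B : LinearMap.BilinForm ℝ L, ∀ x y, A x y = B x y

theorem isBilin_of (A : L → L → ℝ) (h1 : ∀ x x' y, A (x + x') y = A x y + A x' y)
    (h2 : ∀ (c : ℝ) x y, A (c • x) y = c * A x y) (h3 : ∀ x y y', A x (y + y') = A x y + A x y')
    (h4 : ∀ (c : ℝ) x y, A x (c • y) = c * A x y) : IsBilin A :=
  ⟨LinearMap.mk₂ ℝ A h1 h2 h3 h4, fun _ _ => rfl⟩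

theorem isBilin_form (B : LinearMap.BilinForm ℝ L) : IsBilin (fun x y => B x y) :=
  ⟨B, fun _ _ => rfl⟩

theorem IsBilin.add {A B : L → L → ℝ} (hA : IsBilin A) (hB : IsBilin B) :
    IsBilin (fun x y => A x y + B x y) := by
  obtain ⟨a, ha⟩ := hA
  obtain ⟨b, hb⟩ := hB
  exact ⟨a + b, fun x y => by simp [ha, hb]⟩

theorem IsBilin.sum {ι : Type*} [Fintype ι] {A : ι → L → L → ℝ} (hA : ∀ i, IsBilin (A i)) :
    IsBilin (fun x y => ∑ i, A i x y) := by
  choose B hB using hA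
  exact ⟨∑ i, B i, fun x y => by simp [hB, LinearMap.sum_apply]⟩

theorem IsBilin.const_mul {A : L → L → ℝ} (hA : IsBilin A) (c : ℝ) :
    IsBilin (fun x y => c * A x y) := by
  obtain ⟨a, ha⟩ := hA
  exact ⟨c • a, fun x y => by simp [ha]⟩

theorem isBilin_mul (α β : L →ₗ[ℝ] ℝ) : IsBilin (fun x y => α x * β y) :=
  ⟨LinearMap.BilinForm.linMulLin α β, fun x y => by simp⟩

variable [FiniteDimensional ℝ L] {h : LinearMap.BilinForm ℝ L}

theorem dualFrame_eq (hh : h.Nondegenerate) (i) :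
    dualFrame h i = h.dualBasis hh (frame L) i := by
  simp [dualFrame, hh]

theorem apply_sum_dualFrame (hh : h.Nondegenerate) (l : L →ₗ[ℝ] ℝ) (z : L) :
    h (∑ i, l (frame L i) • dualFrame h i) z = l z := by
  have : h (∑ i, l (frame L i) • dualFrame h i) = l := by
    refine (frame L).ext fun j => ?_
    simp only [map_sum, map_smul, LinearMap.sum_apply, LinearMap.smul_apply, dualFrame_eq hh,
      LinearMap.BilinForm.apply_dualBasis_left, smul_eq_mul]
    simp
  rw [this]

omit [FiniteDimensional ℝ L] in
theorem eq_of_forall_apply_eq (hh : h.Nondegenerate) {v w : L} (hvw : ∀ z, h v z = h w z) :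
    v = w :=
  LinearMap.ker_eq_bot.mp hh.ker_eq_bot (LinearMap.ext hvw)

/-- This evaluates `nabla`: a vector representing the Koszul functional must be the sum defining
`nabla`. -/
theorem sum_dualFrame_eq (hh : h.Nondegenerate) (d : L) :
    ∑ i, h d (frame L i) • dualFrame h i = d :=
  eq_of_forall_apply_eq hh (apply_sum_dualFrame hh (h d))

/-- Independence of the contraction from the basis, which permits orthonormal bases in place of the
arbitrary `frame`. -/
theorem metricTrace_eq_sum {ι : Type*} [Fintype ι] [DecidableEq ι] (hh : h.Nondegenerate)
    (b : Module.Basis ι ℝ L) (d : ι → L)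
    (hd : ∀ i j, h (d i) (b j) = if i = j then 1 else 0) {A : L → L → ℝ} (hA : IsBilin A) :
    metricTrace h A = ∑ j, A (b j) (d j) := by
  obtain ⟨B, hB⟩ := hA
  simp only [metricTrace, hB]
  -- Pairing with `d j` reads off the `j`-th coordinate in the basis `b`.
  have h1 : ∀ i j, b.repr (frame L i) j = h (d j) (frame L i) := by
    intro i j
    conv_rhs => rw [← b.sum_repr (frame L i), map_sum]
    simp only [map_smul, hd, smul_eq_mul]
    simp
  calc ∑ i, B (frame L i) (dualFrame h i)
      = ∑ i, ∑ j, h (d j) (frame L i) * B (b j) (dualFrame h i) := by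
        refine Finset.sum_congr rfl fun i _ => ?_
        conv_lhs => rw [← b.sum_repr (frame L i)]
        simp [h1]
    _ = ∑ j, B (b j) (∑ i, h (d j) (frame L i) • dualFrame h i) := by
        rw [Finset.sum_comm]
        simp
    _ = ∑ j, B (b j) (d j) := by simp only [sum_dualFrame_eq hh]

theorem metricTrace_add (A B : L → L → ℝ) :
    metricTrace h (fun x y => A x y + B x y) = metricTrace h A + metricTrace h B := by
  simp [metricTrace, Finset.sum_add_distrib]

theorem metricTrace_sub (A B : L → L → ℝ) :
    metricTrace h (fun x y => A x y - B x y) = metricTrace h A - metricTrace h B := by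
  simp [metricTrace, Finset.sum_sub_distrib]

theorem metricTrace_const_mul (c : ℝ) (A : L → L → ℝ) :
    metricTrace h (fun x y => c * A x y) = c * metricTrace h A := by
  simp [metricTrace, Finset.mul_sum]

omit [FiniteDimensional ℝ L] in
theorem IsRiemannian.nondegenerate (hR : IsRiemannian h) : h.Nondegenerate := by
  constructor
  · intro x hx
    by_contra h0
    exact (hR.pos x h0).ne' (hx x)
  · intro x hx
    by_contra h0
    exact (hR.pos x h0).ne' (hx x)

theorem IsRiemannian.exists_orthonormal (hR : IsRiemannian h) :
    ∃ b : Module.Basis (Fin (Module.finrank ℝ L)) ℝ L,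
      ∀ i j, h (b i) (b j) = if i = j then 1 else 0 := by
  obtain ⟨v, hv⟩ := LinearMap.BilinForm.exists_orthogonal_basis (B := h)
    ⟨fun x y => by simpa using hR.symm x y⟩
  have hp : ∀ i, 0 < h (v i) (v i) := fun i => hR.pos _ (v.ne_zero i)
  have hs : ∀ i, (Real.sqrt (h (v i) (v i)))⁻¹ ≠ 0 := fun i =>
    inv_ne_zero (Real.sqrt_pos.mpr (hp i)).ne'
  refine ⟨v.unitsSMul fun i => Units.mk0 _ (hs i), fun i j => ?_⟩
  simp only [Module.Basis.unitsSMul_apply, Units.smul_mk0, map_smul, LinearMap.smul_apply,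
    smul_eq_mul]
  split_ifs with hij
  · subst hij
    have := Real.mul_self_sqrt (hp i).le
    have h2 := (Real.sqrt_pos.mpr (hp i)).ne'
    field_simp
    linarith [this]
  · have : h (v i) (v j) = 0 := by simpa using hv hij
    simp [this]

section Orthonormal

variable {ι : Type*} [Fintype ι] [DecidableEq ι] (hh : h.Nondegenerate)
  (b : Module.Basis ι ℝ L) (hb : ∀ i j, h (b i) (b j) = if i = j then 1 else 0)

include hh hb

theorem metricTrace_orthonormal {A : L → L → ℝ} (hA : IsBilin A) :
    metricTrace h A = ∑ j, A (b j) (b j) :=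
  metricTrace_eq_sum hh b b hb hA

theorem tensorInner_orthonormal {A B : L → L → ℝ} (hA : IsBilin A) (hB : IsBilin B) :
    tensorInner h A B = ∑ i, ∑ k, A (b i) (b k) * B (b i) (b k) := by
  obtain ⟨a, ha⟩ := hA
  obtain ⟨b', hb'⟩ := hB
  simp only [tensorInner, ha, hb']
  have h1 : ∀ i, ∑ k, a (frame L i) (frame L k) * b' (dualFrame h i) (dualFrame h k) =
      ∑ k, a (frame L i) (b k) * b' (dualFrame h i) (b k) := fun i =>
    metricTrace_orthonormal hh b hb (isBilin_mul (a (frame L i)) (b' (dualFrame h i)))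
  simp only [h1]
  rw [Finset.sum_comm]
  have h2 : ∀ k, ∑ i, a (frame L i) (b k) * b' (dualFrame h i) (b k) =
      ∑ i, a (b i) (b k) * b' (b i) (b k) := fun k =>
    metricTrace_orthonormal hh b hb (isBilin_mul (a.flip (b k)) (b'.flip (b k)))
  simp only [h2]
  exact Finset.sum_comm

omit [FiniteDimensional ℝ L] hh in
theorem apply_eq_sum_orthonormal (x y : L) : h x y = ∑ i, h x (b i) * h y (b i) := by
  have h1 : ∀ x, x = ∑ i, h x (b i) • b i := by
    intro x
    have h2 : ∀ i, b.repr x i = h x (b i) := by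
      intro i
      conv_rhs => rw [← b.sum_repr x, map_sum, LinearMap.sum_apply]
      simp only [map_smul, LinearMap.smul_apply, hb, smul_eq_mul]
      simp
    conv_lhs => rw [← b.sum_repr x]
    simp [h2]
  conv_lhs => rw [h1 y]
  simp [mul_comm]

end Orthonormal

theorem tensorInner_self_nonneg (hR : IsRiemannian h) {A : L → L → ℝ} (hA : IsBilin A) :
    0 ≤ tensorInner h A A := by
  obtain ⟨b, hb⟩ := hR.exists_orthonormal
  rw [tensorInner_orthonormal hR.nondegenerate b hb hA hA]
  exact Finset.sum_nonneg fun i _ => Finset.sum_nonneg fun k _ => mul_self_nonneg _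

theorem metricTrace_self (hR : IsRiemannian h) :
    metricTrace h (fun x y => h x y) = Module.finrank ℝ L := by
  obtain ⟨b, hb⟩ := hR.exists_orthonormal
  rw [metricTrace_orthonormal hR.nondegenerate b hb (isBilin_form h)]
  simp [hb]

theorem tensorInner_add_smul_self (hR : IsRiemannian h) {A : L → L → ℝ} (hA : IsBilin A) (c : ℝ) :
    tensorInner h (fun x y => A x y + c * h x y) (fun x y => A x y + c * h x y) =
      tensorInner h A A + 2 * c * metricTrace h A + c ^ 2 * Module.finrank ℝ L := by
  obtain ⟨b, hb⟩ := hR.exists_orthonormal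
  have hB : IsBilin (fun x y => A x y + c * h x y) := hA.add ((isBilin_form h).const_mul c)
  rw [tensorInner_orthonormal hR.nondegenerate b hb hB hB,
    tensorInner_orthonormal hR.nondegenerate b hb hA hA,
    metricTrace_orthonormal hR.nondegenerate b hb hA]
  have h1 : ∀ i k, (A (b i) (b k) + c * h (b i) (b k)) * (A (b i) (b k) + c * h (b i) (b k)) =
      A (b i) (b k) * A (b i) (b k) + (if i = k then 2 * c * A (b i) (b k) + c ^ 2 else 0) := by
    intro i k
    rw [hb]
    split_ifs <;> ring
  simp only [h1, Finset.sum_add_distrib]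
  simp [Finset.sum_add_distrib, Finset.mul_sum]
  ring

/-- The trace of the square of a symmetric endomorphism. -/
theorem metricTrace_sq (hR : IsRiemannian h) {A : L → L → ℝ} (hA : IsBilin A) (K : L →ₗ[ℝ] L)
    (hK : ∀ x y, h (K x) y = A x y) :
    metricTrace h (fun x y => h (K x) (K y)) = tensorInner h A A := by
  obtain ⟨b, hb⟩ := hR.exists_orthonormal
  rw [tensorInner_orthonormal hR.nondegenerate b hb hA hA,
    metricTrace_orthonormal hR.nondegenerate b hb]
  · refine Finset.sum_congr rfl fun i _ => ?_
    rw [apply_eq_sum_orthonormal b hb]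
    simp [hK]
  · exact ⟨h.comp K K, fun _ _ => by simp⟩

theorem metricTrace_mul (hR : IsRiemannian h) {A : L → L → ℝ} (hA : IsBilin A)
    (hs : ∀ x y, A x y = A y x) (K : L →ₗ[ℝ] L) (hK : ∀ x y, h (K x) y = A x y) (y z : L) :
    metricTrace h (fun x w => A x z * A y w) = h (K y) (K z) := by
  obtain ⟨b, hb⟩ := hR.exists_orthonormal
  obtain ⟨a, ha⟩ := hA
  have hB : IsBilin (fun x w => A x z * A y w) :=
    ⟨LinearMap.BilinForm.linMulLin (a.flip z) (a y), fun x w => by simp [ha]⟩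
  rw [metricTrace_orthonormal hR.nondegenerate b hb hB, apply_eq_sum_orthonormal b hb]
  refine Finset.sum_congr rfl fun i _ => ?_
  rw [hK, hK, hs z, mul_comm]

section Product

variable {g : LinearMap.BilinForm ℝ (L × ℝ)} (hR : IsRiemannian h)
  (hg : ∀ X Y, g X Y = h X.1 Y.1 - X.2 * Y.2)

include hR hg

omit [FiniteDimensional ℝ L] in
theorem nondegenerate_prod : g.Nondegenerate := by
  have hs : ∀ X Y, g X Y = g Y X := fun X Y => by rw [hg, hg, hR.symm, mul_comm]
  have key : ∀ X, (∀ Y, g X Y = 0) → X = 0 := by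
    intro X hX
    have h1 : X.2 = 0 := by simpa [hg] using hX (0, 1)
    have h2 : X.1 = 0 := by
      by_contra h0
      have := hX (X.1, 0)
      simp only [hg, mul_zero, sub_zero] at this
      exact (hR.pos _ h0).ne' this
    exact Prod.ext h2 h1
  exact ⟨key, fun X hX => key X fun Y => by rw [hs]; exact hX Y⟩

theorem metricTrace_prod {A : L × ℝ → L × ℝ → ℝ} (hA : IsBilin A) :
    metricTrace g A = metricTrace h (fun x y => A (x, 0) (y, 0)) - A (0, 1) (0, 1) := by
  obtain ⟨b, hb⟩ := hR.exists_orthonormal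
  let bb := b.prod (Module.Basis.singleton Unit ℝ)
  -- Since ∂_t is timelike, its dual vector is -∂_t; this is the source of the minus sign.
  have h1 := metricTrace_eq_sum (nondegenerate_prod hR hg) bb
    (Sum.elim (fun i => (b i, 0)) (fun _ => (0, -1))) ?_ hA
  · rw [h1, metricTrace_orthonormal hR.nondegenerate b hb]
    · obtain ⟨B, hB⟩ := hA
      have h2 : B (0, 1) (0, -1) = -B (0, 1) (0, 1) := by
        rw [← map_neg]
        simp
      simp only [Fintype.sum_sum_type, bb, hB]
      simp [h2, sub_eq_add_neg]
    · obtain ⟨B, hB⟩ := hA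
      exact ⟨B.comp (LinearMap.inl ℝ L ℝ) (LinearMap.inl ℝ L ℝ), fun x y => by simp [hB]⟩
  · rintro (i | i) (j | j) <;> simp [bb, hg, hb]

end Product

end LinearAlgebra

/-! ### Levi-Civita connection and curvature of a left-invariant metric on the group. -/

section GroupGeometry

variable {L : Type*} [LieRing L]

/-- The right-hand side of the Koszul formula on left-invariant fields. -/
noncomputable def liftBracket (A : L → L → ℝ) (x y z : L) : ℝ :=
  (A ⁅x, y⁆ z - A ⁅x, z⁆ y - A ⁅y, z⁆ x) / 2

variable [LieAlgebra ℝ L]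

variable [FiniteDimensional ℝ L] {h : LinearMap.BilinForm ℝ L}

/-- Packaging the connection as a bilinear map lets later curvature identities be expanded by
linearity. Bilinearity is inherited from the Koszul expression through nondegeneracy. -/
theorem exists_connection (hh : h.Nondegenerate) :
    ∃ D : L →ₗ[ℝ] L →ₗ[ℝ] L, ∀ x y z, h (D x y) z = liftBracket (fun u v => h u v) x y z := by
  let l : L → L → L →ₗ[ℝ] ℝ := fun x y =>
    { toFun := fun z => liftBracket (fun u v => h u v) x y z
      map_add' := fun z z' => by
        simp only [liftBracket, lie_add, map_add, LinearMap.add_apply]; ring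
      map_smul' := fun c z => by
        simp only [liftBracket, lie_smul, map_smul, LinearMap.smul_apply, smul_eq_mul,
          RingHom.id_apply]; ring }
  let f : L → L → L := fun x y => ∑ i, l x y (frame L i) • dualFrame h i
  have hf : ∀ x y z, h (f x y) z = liftBracket (fun u v => h u v) x y z := fun x y z =>
    apply_sum_dualFrame hh (l x y) z
  refine ⟨LinearMap.mk₂ ℝ f ?_ ?_ ?_ ?_, hf⟩
  · intro x x' y
    refine eq_of_forall_apply_eq hh fun z => ?_
    simp only [map_add, LinearMap.add_apply, hf, liftBracket, add_lie]; ring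
  · intro c x y
    refine eq_of_forall_apply_eq hh fun z => ?_
    simp only [map_smul, LinearMap.smul_apply, smul_eq_mul, hf, liftBracket, smul_lie]
    ring
  · intro x x' y
    refine eq_of_forall_apply_eq hh fun z => ?_
    simp only [map_add, LinearMap.add_apply, hf, liftBracket, add_lie, lie_add]; ring
  · intro c x y
    refine eq_of_forall_apply_eq hh fun z => ?_
    simp only [map_smul, LinearMap.smul_apply, smul_eq_mul, hf, liftBracket, smul_lie, lie_smul]
    ring

omit [FiniteDimensional ℝ L] in
theorem koszul_group (x y z : L) (t : ℝ) :
    koszul univ 0 (fun _ => h) x y z t = liftBracket (fun u v => h u v) x y z := by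
  simp [koszul, alongField, liftBracket]

theorem nabla_group (hh : h.Nondegenerate) {D : L →ₗ[ℝ] L →ₗ[ℝ] L}
    (hD : ∀ x y z, h (D x y) z = liftBracket (fun u v => h u v) x y z) (x y : L) (t : ℝ) :
    nabla univ 0 (fun _ => h) x y t = D x y := by
  simp only [nabla, koszul_group, ← hD]
  exact sum_dualFrame_eq hh _

theorem riemann_group (hh : h.Nondegenerate) {D : L →ₗ[ℝ] L →ₗ[ℝ] L}
    (hD : ∀ x y z, h (D x y) z = liftBracket (fun u v => h u v) x y z) (x y z w : L) (t : ℝ) :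
    riemann univ 0 (fun _ => h) x y z w t =
      h (D x z) (D y w) - h (D y z) (D x w) - liftBracket (fun u v => h u v) ⁅x, y⁆ z w := by
  simp only [riemann, nabla_group hh hD, koszul_group, alongField, LinearMap.zero_apply, zero_mul]
  ring

end GroupGeometry

/-! ### Connection and Riemann tensor of the space-time in terms of γ, k and the time derivative of
k. -/

namespace Model

variable {𝔤 : Type*} [LieRing 𝔤] [LieAlgebra ℝ 𝔤] [FiniteDimensional ℝ 𝔤] (M : Model 𝔤)

theorem uniqueDiff_I : UniqueDiffOn ℝ M.I := uniqueDiffOn_Ici _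

/-- The time derivative of the tensor `k`. -/
noncomputable def kdot (t : ℝ) (x y : 𝔤) : ℝ := derivWithin (fun s => M.k s x y) M.I t

variable {M} {t : ℝ} (ht : t ∈ M.I)

include ht

theorem hasDerivWithinAt_γ (x y : 𝔤) :
    HasDerivWithinAt (fun s => M.γ s x y) (-2 * M.k t x y) M.I t := by
  have h1 := ((M.γ_contDiff x y).differentiableOn (by norm_num) t ht).hasDerivWithinAt
  convert! h1 using 1
  simp only [k, I]
  ring

theorem hasDerivWithinAt_k (x y : 𝔤) :
    HasDerivWithinAt (fun s => M.k s x y) (M.kdot t x y) M.I t := by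
  have h1 : ContDiffOn ℝ 1 (derivWithin (fun s => M.γ s x y) M.I) M.I :=
    (M.γ_contDiff x y).derivWithin M.uniqueDiff_I (by norm_num)
  have h2 : DifferentiableOn ℝ (fun s => M.k s x y) M.I :=
    (h1.differentiableOn (by norm_num)).const_mul _
  exact (h2 t ht).hasDerivWithinAt

theorem k_symm (x y : 𝔤) : M.k t x y = M.k t y x := by
  simp only [k]
  congr 1
  exact derivWithin_congr (fun s hs => (M.γ_riemannian s hs).symm x y)
    ((M.γ_riemannian t ht).symm x y)

/-- Bilinearity of γ passes to `k`, which is defined entry by entry, by uniqueness of one-sided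
derivatives on the time interval. -/
theorem isBilin_k : IsBilin (M.k t) := by
  have key : ∀ (f : ℝ → ℝ) (x y : 𝔤) (d : ℝ), (f = fun s => M.γ s x y) →
      HasDerivWithinAt f (-2 * d) M.I t → M.k t x y = d := by
    intro f x y d hf hd
    subst hf
    have := ((hasDerivWithinAt_γ ht x y).derivWithin (M.uniqueDiff_I t ht)).symm.trans
      (hd.derivWithin (M.uniqueDiff_I t ht))
    linarith
  refine isBilin_of _ ?_ ?_ ?_ ?_
  · intro x x' y
    refine key _ _ _ _ ?_ (((hasDerivWithinAt_γ ht x y).add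
      (hasDerivWithinAt_γ ht x' y)).congr_deriv (by ring))
    ext s; simp
  · intro c x y
    refine key _ _ _ _ ?_ (((hasDerivWithinAt_γ ht x y).const_mul c).congr_deriv (by ring))
    ext s; simp
  · intro x y y'
    refine key _ _ _ _ ?_ (((hasDerivWithinAt_γ ht x y).add
      (hasDerivWithinAt_γ ht x y')).congr_deriv (by ring))
    ext s; simp
  · intro c x y
    refine key _ _ _ _ ?_ (((hasDerivWithinAt_γ ht x y).const_mul c).congr_deriv (by ring))
    ext s; simp

theorem isBilin_kdot : IsBilin (M.kdot t) := by
  have key : ∀ (f : ℝ → ℝ) (x y : 𝔤) (d : ℝ), (∀ s ∈ M.I, M.k s x y = f s) →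
      HasDerivWithinAt f d M.I t → M.kdot t x y = d := by
    intro f x y d hf hd
    exact ((hd.congr hf (hf t ht)).derivWithin (M.uniqueDiff_I t ht))
  refine isBilin_of _ ?_ ?_ ?_ ?_
  · intro x x' y
    refine key _ _ _ _ (fun s hs => ?_) ((hasDerivWithinAt_k ht x y).add
      (hasDerivWithinAt_k ht x' y))
    obtain ⟨B, hB⟩ := isBilin_k hs
    simp [hB]
  · intro c x y
    refine key _ _ _ _ (fun s hs => ?_) ((hasDerivWithinAt_k ht x y).const_mul c)
    obtain ⟨B, hB⟩ := isBilin_k hs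
    simp [hB]
  · intro x y y'
    refine key _ _ _ _ (fun s hs => ?_) ((hasDerivWithinAt_k ht x y).add
      (hasDerivWithinAt_k ht x y'))
    obtain ⟨B, hB⟩ := isBilin_k hs
    simp [hB]
  · intro c x y
    refine key _ _ _ _ (fun s hs => ?_) ((hasDerivWithinAt_k ht x y).const_mul c)
    obtain ⟨B, hB⟩ := isBilin_k hs
    simp [hB]

theorem hasDerivWithinAt_g (X Y : 𝔤 × ℝ) :
    HasDerivWithinAt (fun s => M.g s X Y) (-2 * M.k t X.1 Y.1) M.I t := by
  simp only [g_apply]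
  exact (hasDerivWithinAt_γ ht X.1 Y.1).sub_const _

theorem koszul_spacetime (X Y Z : 𝔤 × ℝ) :
    koszul M.I (dt 𝔤) M.g X Y Z t = liftBracket (fun u v => M.γ t u v) X.1 Y.1 Z.1
      - X.2 * M.k t Y.1 Z.1 - Y.2 * M.k t X.1 Z.1 + Z.2 * M.k t X.1 Y.1 := by
  simp only [koszul, alongField, (hasDerivWithinAt_g ht _ _).derivWithin (M.uniqueDiff_I t ht)]
  simp only [g_apply, dt, LinearMap.snd_apply, Bracket.bracket, liftBracket]
  ring

theorem hasDerivWithinAt_koszul (X Y Z : 𝔤 × ℝ) :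
    HasDerivWithinAt (koszul M.I (dt 𝔤) M.g X Y Z)
      (-2 * liftBracket (M.k t) X.1 Y.1 Z.1 - X.2 * M.kdot t Y.1 Z.1 - Y.2 * M.kdot t X.1 Z.1
        + Z.2 * M.kdot t X.1 Y.1) M.I t := by
  refine HasDerivWithinAt.congr ?_ (fun s hs => koszul_spacetime hs X Y Z)
    (koszul_spacetime ht X Y Z)
  refine (HasDerivWithinAt.add (.sub (.sub ?_ ((hasDerivWithinAt_k ht _ _).const_mul _))
    ((hasDerivWithinAt_k ht _ _).const_mul _)) ((hasDerivWithinAt_k ht _ _).const_mul _))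
  simp only [liftBracket]
  refine ((((hasDerivWithinAt_γ ht _ _).sub (hasDerivWithinAt_γ ht _ _)).sub
    (hasDerivWithinAt_γ ht _ _)).div_const 2).congr_deriv ?_
  ring

theorem nondegenerate_g : (M.g t).Nondegenerate :=
  nondegenerate_prod (M.γ_riemannian t ht) (M.g_apply t)

section Connection

variable {K : 𝔤 →ₗ[ℝ] 𝔤} (hK : ∀ x y, M.γ t (K x) y = M.k t x y) {D : 𝔤 →ₗ[ℝ] 𝔤 →ₗ[ℝ] 𝔤}
  (hD : ∀ x y z, M.γ t (D x y) z = liftBracket (fun u v => M.γ t u v) x y z)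

include hK hD

theorem nabla_spacetime (X Y : 𝔤 × ℝ) :
    nabla M.I (dt 𝔤) M.g X Y t =
      (D X.1 Y.1 - X.2 • K Y.1 - Y.2 • K X.1, -M.k t X.1 Y.1) := by
  have h1 : ∀ Z, koszul M.I (dt 𝔤) M.g X Y Z t =
      M.g t (D X.1 Y.1 - X.2 • K Y.1 - Y.2 • K X.1, -M.k t X.1 Y.1) Z := by
    intro Z
    rw [koszul_spacetime ht, g_apply]
    simp only [map_sub, map_smul, LinearMap.sub_apply, LinearMap.smul_apply, hK, hD, smul_eq_mul]
    ring
  simp only [nabla, h1]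
  exact sum_dualFrame_eq (nondegenerate_g ht) _

/-- All components at once: the Gauss, Codazzi and normal-normal parts correspond to the powers of
the time components `X.2`, `Y.2`, `Z.2`, `W.2`. -/
theorem riemann_spacetime (X Y Z W : 𝔤 × ℝ) :
    riemann M.I (dt 𝔤) M.g X Y Z W t =
      X.2 * (-2 * liftBracket (M.k t) Y.1 Z.1 W.1 - Y.2 * M.kdot t Z.1 W.1
        - Z.2 * M.kdot t Y.1 W.1 + W.2 * M.kdot t Y.1 Z.1)
      - (M.γ t (D Y.1 Z.1 - Y.2 • K Z.1 - Z.2 • K Y.1) (D X.1 W.1 - X.2 • K W.1 - W.2 • K X.1)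
        - M.k t Y.1 Z.1 * M.k t X.1 W.1)
      - (Y.2 * (-2 * liftBracket (M.k t) X.1 Z.1 W.1 - X.2 * M.kdot t Z.1 W.1
        - Z.2 * M.kdot t X.1 W.1 + W.2 * M.kdot t X.1 Z.1)
      - (M.γ t (D X.1 Z.1 - X.2 • K Z.1 - Z.2 • K X.1) (D Y.1 W.1 - Y.2 • K W.1 - W.2 • K Y.1)
        - M.k t X.1 Z.1 * M.k t Y.1 W.1))
      - (liftBracket (fun u v => M.γ t u v) ⁅X.1, Y.1⁆ Z.1 W.1
        - Z.2 * M.k t ⁅X.1, Y.1⁆ W.1 + W.2 * M.k t ⁅X.1, Y.1⁆ Z.1) := by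
  have h1 : (⁅X, Y⁆ : 𝔤 × ℝ) = (⁅X.1, Y.1⁆, 0) := rfl
  simp only [riemann, alongField, nabla_spacetime ht hK hD, g_apply,
    (hasDerivWithinAt_koszul ht _ _ _).derivWithin (M.uniqueDiff_I t ht),
    koszul_spacetime ht, h1]
  simp only [dt, LinearMap.snd_apply]
  ring

theorem isBilin_riemann_outer (Y Z : 𝔤 × ℝ) :
    IsBilin (fun X W => riemann M.I (dt 𝔤) M.g X Y Z W t) := by
  obtain ⟨k, hk⟩ := isBilin_k ht
  obtain ⟨kd, hkd⟩ := isBilin_kdot ht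
  simp only [riemann_spacetime ht hK hD, liftBracket, hk, hkd]
  refine isBilin_of _ ?_ ?_ ?_ ?_ <;> intros <;>
    simp only [Prod.fst_add, Prod.snd_add, Prod.smul_fst, Prod.smul_snd, map_add, map_smul, map_sub,
      LinearMap.add_apply, LinearMap.sub_apply, LinearMap.smul_apply, smul_eq_mul, lie_add, add_lie,
      lie_smul, smul_lie] <;> ring

theorem isBilin_riemann_inner (X W : 𝔤 × ℝ) :
    IsBilin (fun Y Z => riemann M.I (dt 𝔤) M.g X Y Z W t) := by
  obtain ⟨k, hk⟩ := isBilin_k ht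
  obtain ⟨kd, hkd⟩ := isBilin_kdot ht
  simp only [riemann_spacetime ht hK hD, liftBracket, hk, hkd]
  refine isBilin_of _ ?_ ?_ ?_ ?_ <;> intros <;>
    simp only [Prod.fst_add, Prod.snd_add, Prod.smul_fst, Prod.smul_snd, map_add, map_smul, map_sub,
      LinearMap.add_apply, LinearMap.sub_apply, LinearMap.smul_apply, smul_eq_mul, lie_add, add_lie,
      lie_smul, smul_lie] <;> ring

theorem isBilin_ricci : IsBilin (fun Y Z => ricci M.I (dt 𝔤) M.g Y Z t) := by
  simp only [ricci, metricTrace]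
  exact IsBilin.sum fun _ => isBilin_riemann_inner ht hK hD _ _

end Connection

end Model

/-! ### Time derivative of a trace with respect to a moving metric. -/

open scoped Matrix.Norms.Operator in
theorem hasDerivWithinAt_matrix_inv {ι : Type*} [Fintype ι] [DecidableEq ι]
    {G : ℝ → Matrix ι ι ℝ} {G' : Matrix ι ι ℝ} {s : Set ℝ} {t : ℝ}
    (hG : ∀ i j, HasDerivWithinAt (fun u => G u i j) (G' i j) s t) (hu : IsUnit (G t)) (i j : ι) :
    HasDerivWithinAt (fun u => (G u)⁻¹ i j) (-((G t)⁻¹ * G' * (G t)⁻¹) i j) s t := by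
  -- Entrywise derivatives are assembled into a matrix derivative, so that the derivative of
  -- inversion in a normed algebra applies.
  have h1 : HasDerivWithinAt G G' s t := by
    have h2 : HasDerivWithinAt (fun u => ∑ i, ∑ j, G u i j • Matrix.single i j (1 : ℝ))
        (∑ i, ∑ j, G' i j • Matrix.single i j (1 : ℝ)) s t :=
      HasDerivWithinAt.fun_sum fun i _ => HasDerivWithinAt.fun_sum fun j _ =>
        (hG i j).smul_const _
    have h3 : ∀ A : Matrix ι ι ℝ, ∑ i, ∑ j, A i j • Matrix.single i j (1 : ℝ) = A := by
      intro A
      conv_rhs => rw [Matrix.matrix_eq_sum_single A]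
      simp
    simpa only [h3] using h2
  obtain ⟨x, hx⟩ := hu
  have h4 := (hasFDerivAt_ringInverse (𝕜 := ℝ) x)
  rw [hx] at h4
  have h5 := h4.comp_hasDerivWithinAt t h1
  have h6 : HasDerivWithinAt (fun u => (G u)⁻¹) (-((G t)⁻¹ * G' * (G t)⁻¹)) s t := by
    have h7 : (x⁻¹).val = (G t)⁻¹ := by rw [← hx, Matrix.coe_units_inv]
    convert! h5 using 1
    · ext u : 1
      simp [Matrix.nonsing_inv_eq_ringInverse]
    · simp [h7]
  let e : Matrix ι ι ℝ →ₗ[ℝ] ℝ := Matrix.entryLinearMap ℝ ℝ i j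
  exact (LinearMap.toContinuousLinearMap e).hasFDerivAt.comp_hasDerivWithinAt t h6

section Trace

variable {L : Type*} [AddCommGroup L] [Module ℝ L] [FiniteDimensional ℝ L]

/-- The Gram matrix of the frame. -/
noncomputable def gram (h : LinearMap.BilinForm ℝ L) :
    Matrix (Fin (Module.finrank ℝ L)) (Fin (Module.finrank ℝ L)) ℝ :=
  Matrix.of fun i j => h (frame L i) (frame L j)

theorem gram_mul {h : LinearMap.BilinForm ℝ L} (hh : h.Nondegenerate) :
    (Matrix.of fun i j => (frame L).repr (dualFrame h i) j) * gram h = 1 := by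
  ext i j
  have : h (dualFrame h i) (frame L j) = if i = j then 1 else 0 := by
    rw [dualFrame_eq hh, LinearMap.BilinForm.apply_dualBasis_left]
    simp only [eq_comm]
  rw [Matrix.mul_apply, Matrix.one_apply, ← this]
  conv_rhs => rw [← (frame L).sum_repr (dualFrame h i), map_sum, LinearMap.sum_apply]
  simp [gram]

theorem dualFrame_eq_sum {h : LinearMap.BilinForm ℝ L} (hh : h.Nondegenerate) (i) :
    dualFrame h i = ∑ j, (gram h)⁻¹ i j • frame L j := by
  rw [Matrix.inv_eq_left_inv (gram_mul hh)]
  simp [(frame L).sum_repr]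

/-- The frame is fixed, so the metric enters only through the inverse Gram matrix. Its derivative
-G⁻¹(-2k)G⁻¹ contributes the term 2|k|². -/
theorem hasDerivWithinAt_metricTrace {γ : ℝ → LinearMap.BilinForm ℝ L} {k : ℝ → L → L → ℝ}
    {kd : L → L → ℝ} {s : Set ℝ} {t : ℝ} (ht : t ∈ s) (hγ : ∀ u ∈ s, (γ u).Nondegenerate)
    (hγd : ∀ x y, HasDerivWithinAt (fun u => γ u x y) (-2 * k t x y) s t)
    (hk : ∀ u ∈ s, IsBilin (k u)) (hkd : IsBilin kd)
    (hkk : ∀ x y, HasDerivWithinAt (fun u => k u x y) (kd x y) s t)  (hγs : ∀ x y, γ t x y = γ t y x) :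
    HasDerivWithinAt (fun u => metricTrace (γ u) (k u))
      (metricTrace (γ t) kd + 2 * tensorInner (γ t) (k t) (k t)) s t := by
  have h1 : ∀ u ∈ s, ∀ A : L → L → ℝ, IsBilin A → metricTrace (γ u) A =
      ∑ i, ∑ j, (gram (γ u))⁻¹ i j * A (frame L i) (frame L j) := by
    rintro u hu A ⟨B, hB⟩
    simp only [metricTrace, dualFrame_eq_sum (hγ u hu), hB, map_sum, map_smul, smul_eq_mul]
  refine HasDerivWithinAt.congr ?_ (fun u hu => h1 u hu _ (hk u hu)) (h1 t ht _ (hk t ht))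
  have h2 : IsUnit (gram (γ t)) :=
    (Matrix.isUnit_iff_isUnit_det _).mpr (Matrix.isUnit_det_of_left_inverse (gram_mul (hγ t ht)))
  have h3 := hasDerivWithinAt_matrix_inv (G := fun u => gram (γ u))
    (G' := Matrix.of fun i j => -2 * k t (frame L i) (frame L j))
    (fun i j => hγd (frame L i) (frame L j)) h2
  refine (HasDerivWithinAt.fun_sum fun i _ => HasDerivWithinAt.fun_sum fun j _ =>
    (h3 i j).mul (hkk (frame L i) (frame L j))).congr_deriv ?_
  conv_rhs => rw [add_comm, h1 t ht _ hkd]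
  simp only [Finset.sum_add_distrib]
  congr 1
  have hsym : ∀ i j, (gram (γ t))⁻¹ i j = (gram (γ t))⁻¹ j i := by
    intro i j
    have h4 : (gram (γ t)).transpose = gram (γ t) := by
      ext i j
      simp [gram, hγs]
    conv_rhs => rw [← h4, ← Matrix.transpose_nonsing_inv, Matrix.transpose_apply]
  obtain ⟨B, hB⟩ := hk t ht
  simp only [tensorInner, dualFrame_eq_sum (hγ t ht), Matrix.mul_apply, hB, map_sum, map_smul,
    smul_eq_mul, LinearMap.sum_apply, LinearMap.smul_apply, Matrix.of_apply, Finset.mul_sum,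
    Finset.sum_mul, ← Finset.sum_neg_distrib]
  refine Finset.sum_congr rfl fun i _ => Finset.sum_congr rfl fun j _ => ?_
  refine Finset.sum_congr rfl fun p _ => Finset.sum_congr rfl fun q _ => ?_
  rw [hsym j]
  ring

end Trace

/-! ### Ricci and scalar curvature of the space-time. -/

namespace Model

variable {𝔤 : Type*} [LieRing 𝔤] [LieAlgebra ℝ 𝔤] [FiniteDimensional ℝ 𝔤] {M : Model 𝔤}

section Curvature

variable {t : ℝ} (ht : t ∈ M.I)

include ht

theorem hasDerivWithinAt_trace_k :
    HasDerivWithinAt (fun s => metricTrace (M.γ s) (M.k s))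
      (metricTrace (M.γ t) (M.kdot t) + 2 * tensorInner (M.γ t) (M.k t) (M.k t)) M.I t :=
  hasDerivWithinAt_metricTrace ht (fun s hs => (M.γ_riemannian s hs).nondegenerate)
    (hasDerivWithinAt_γ ht) (fun _ hs => isBilin_k hs) (isBilin_kdot ht) (hasDerivWithinAt_k ht)
    (M.γ_riemannian t ht).symm

theorem exists_weingarten : ∃ K : 𝔤 →ₗ[ℝ] 𝔤, ∀ x y, M.γ t (K x) y = M.k t x y := by
  obtain ⟨B, hB⟩ := isBilin_k ht
  refine ⟨B.symmCompOfNondegenerate (M.γ t) (M.γ_riemannian t ht).nondegenerate, fun x y => ?_⟩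
  rw [LinearMap.BilinForm.symmCompOfNondegenerate_left_apply, hB]

theorem ricci_dt :
    ricci M.I (dt 𝔤) M.g (0, 1) (0, 1) t =
      metricTrace (M.γ t) (M.kdot t) + tensorInner (M.γ t) (M.k t) (M.k t) := by
  have hR := M.γ_riemannian t ht
  obtain ⟨K, hK⟩ := exists_weingarten ht
  obtain ⟨D, hD⟩ := exists_connection hR.nondegenerate
  rw [ricci, metricTrace_prod hR (M.g_apply t) (isBilin_riemann_outer ht hK hD _ _)]
  obtain ⟨k, hk⟩ := isBilin_k ht
  obtain ⟨kd, hkd⟩ := isBilin_kdot ht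
  rw [← metricTrace_sq hR (isBilin_k ht) K hK, ← metricTrace_add]
  simp [riemann_spacetime ht hK hD, liftBracket, hk, hkd, add_comm]

/-- The contracted Gauss equation: the spatial trace gives the first three terms, the normal
direction the last bracket. -/
theorem ricci_spatial {K : 𝔤 →ₗ[ℝ] 𝔤} (hK : ∀ x y, M.γ t (K x) y = M.k t x y) (y z : 𝔤) :
    ricci M.I (dt 𝔤) M.g (y, 0) (z, 0) t =
      ricci univ 0 (fun _ => M.γ t) y z 0 + M.k t y z * metricTrace (M.γ t) (M.k t)
        - M.γ t (K y) (K z) - (M.kdot t y z + M.γ t (K y) (K z)) := by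
  have hR := M.γ_riemannian t ht
  obtain ⟨D, hD⟩ := exists_connection hR.nondegenerate
  rw [ricci, metricTrace_prod hR (M.g_apply t) (isBilin_riemann_outer ht hK hD _ _)]
  rw [ricci, ← metricTrace_const_mul,
    ← metricTrace_mul hR (isBilin_k ht) (k_symm ht) K hK, ← metricTrace_add, ← metricTrace_sub,
    metricTrace_mul hR (isBilin_k ht) (k_symm ht) K hK]
  obtain ⟨k, hk⟩ := isBilin_k ht
  obtain ⟨kd, hkd⟩ := isBilin_kdot ht
  congr 1
  · congr 1
    ext x w
    rw [riemann_spacetime ht hK hD, riemann_group hR.nondegenerate hD]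
    simp
    ring
  · simp [riemann_spacetime ht hK hD, liftBracket, hk, hkd, hR.symm (K z)]

/-- Keeping Rc(∂_t, ∂_t) unexpanded isolates the second time derivatives, which then cancel in the
(∂_t, ∂_t) component of the Einstein tensor. -/
theorem scalarCurv_spacetime :
    scalarCurv M.I (dt 𝔤) M.g t = M.spatialCurv t + metricTrace (M.γ t) (M.k t) ^ 2
      - tensorInner (M.γ t) (M.k t) (M.k t) - 2 * ricci M.I (dt 𝔤) M.g (0, 1) (0, 1) t := by
  have hR := M.γ_riemannian t ht
  obtain ⟨K, hK⟩ := exists_weingarten ht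
  obtain ⟨D, hD⟩ := exists_connection hR.nondegenerate
  rw [scalarCurv, metricTrace_prod hR (M.g_apply t) (isBilin_ricci ht hK hD)]
  simp only [ricci_spatial ht hK, metricTrace_sub, metricTrace_add]
  simp only [mul_comm (M.k t _ _) (metricTrace _ _), metricTrace_const_mul,
    metricTrace_sq hR (isBilin_k ht) K hK]
  rw [ricci_dt ht, spatialCurv, groupScalarCurv, scalarCurv]
  ring

omit ht in
theorem trace_k (hn : 0 < Module.finrank ℝ 𝔤) : metricTrace (M.γ t) (M.k t) = -(M.dim * M.H t) := by
  have : M.dim ≠ 0 := by simp only [dim]; exact_mod_cast hn.ne'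
  rw [H]
  field_simp

/-- The shear is the trace-free part of `k`, orthogonal to the pure-trace part -Hγ. -/
theorem shearSq_eq (hn : 0 < Module.finrank ℝ 𝔤) :
    tensorInner (M.γ t) (M.k t) (M.k t) = M.shearSq t + M.dim * M.H t ^ 2 := by
  have h1 := tensorInner_add_smul_self (M.γ_riemannian t ht) (isBilin_k ht) (M.H t)
  rw [trace_k hn] at h1
  have h2 : M.shearSq t = _ := h1
  rw [h2, dim]
  ring

theorem shearSq_nonneg : 0 ≤ M.shearSq t :=
  tensorInner_self_nonneg (M.γ_riemannian t ht)
    ((isBilin_k ht).add ((isBilin_form _).const_mul _))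

theorem trT_eq : M.trT t = M.trS t - M.ρ t := by
  rw [trT, metricTrace_prod (M.γ_riemannian t ht) (M.g_apply t) (isBilin_form _)]
  simp [T_apply, trS]

theorem covectorSq_dφ : covectorSq (M.g t) (M.dφ t) = -M.φdot t ^ 2 := by
  have h1 : covectorSq (M.g t) (M.dφ t) = metricTrace (M.g t) (fun X Y => M.dφ t X * M.dφ t Y) := rfl
  have h2 : IsBilin (fun X Y => M.dφ t X * M.dφ t Y) :=
    isBilin_mul (M.φdot t • dt 𝔤) (M.φdot t • dt 𝔤) |> fun ⟨B, hB⟩ => ⟨B, fun X Y => by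
      rw [← hB]
      simp only [dφ, alongField, φdot, LinearMap.smul_apply, smul_eq_mul]
      ring⟩
  rw [h1, metricTrace_prod (M.γ_riemannian t ht) (M.g_apply t) h2]
  simp [dφ, alongField, dt, metricTrace, φdot]
  ring

theorem metricTrace_g : metricTrace (M.g t) (fun X Y => M.g t X Y) = M.dim + 1 := by
  rw [metricTrace_prod (M.γ_riemannian t ht) (M.g_apply t) (isBilin_form _)]
  simp [g_apply, metricTrace_self (M.γ_riemannian t ht), dim]

theorem box_eq (hn : 0 < Module.finrank ℝ 𝔤) :
    box M.I (dt 𝔤) M.g M.φ t = -derivWithin M.φdot M.I t - M.dim * M.H t * M.φdot t := by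
  have hR := M.γ_riemannian t ht
  obtain ⟨K, hK⟩ := exists_weingarten ht
  obtain ⟨D, hD⟩ := exists_connection hR.nondegenerate
  have h1 : ∀ X Y : 𝔤 × ℝ, hessian M.I (dt 𝔤) M.g M.φ X Y t =
      X.2 * (Y.2 * derivWithin M.φdot M.I t) + M.φdot t * M.k t X.1 Y.1 := by
    intro X Y
    have h2 : alongField M.I (dt 𝔤) Y M.φ = fun s => Y.2 * M.φdot s := rfl
    rw [hessian, h2]
    simp only [alongField, nabla_spacetime ht hK hD]
    rw [derivWithin_const_mul_field]
    simp only [dt, LinearMap.snd_apply, φdot]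
    ring
  obtain ⟨k, hk⟩ := isBilin_k ht
  simp only [box, h1]
  rw [metricTrace_prod hR (M.g_apply t)]
  · simp only [zero_mul, zero_add, metricTrace_const_mul]
    have h3 : metricTrace (M.γ t) (fun x y => M.k t x y) = -(M.dim * M.H t) := trace_k hn
    simp only [h3, hk]
    simp
    ring
  · refine isBilin_of _ ?_ ?_ ?_ ?_ <;> intros <;> simp [hk] <;> ring

end Curvature

/-! ### Hamiltonian constraint, Raychaudhuri equation and scalar field equation. -/

section Equations

variable {t : ℝ} (ht : t ∈ M.I) (hn : 3 ≤ Module.finrank ℝ 𝔤) (hM : M.SolvesESM)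

include ht hn hM

theorem hamiltonian_constraint :
    M.dim * (M.dim - 1) * M.H t ^ 2 + M.spatialCurv t =
      M.shearSq t + M.φdot t ^ 2 + 2 * M.V (M.φ t) + 2 * (M.C (M.φ t) * M.ρ t) := by
  have h1 := hM.einstein t ht (0, 1) (0, 1)
  rw [scalarCurv_spacetime ht, covectorSq_dφ ht, trace_k (by omega), shearSq_eq ht (by omega),
    g_apply, T_apply] at h1
  simp [dφ, alongField, dt] at h1
  have h2 : derivWithin M.φ M.I t = M.φdot t := rfl
  rw [h2] at h1
  linarith

omit hn in
theorem metricTrace_einstein :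
    (1 - M.dim) * scalarCurv M.I (dt 𝔤) M.g t = (M.dim - 1) * M.φdot t ^ 2
      - 2 * (M.dim + 1) * M.V (M.φ t) + 2 * (M.C (M.φ t) * (M.trS t - M.ρ t)) := by
  have h1 : metricTrace (M.g t) (fun X Y => ricci M.I (dt 𝔤) M.g X Y t
      - 1 / 2 * scalarCurv M.I (dt 𝔤) M.g t * M.g t X Y) = metricTrace (M.g t) (fun X Y =>
        M.dφ t X * M.dφ t Y - 1 / 2 * covectorSq (M.g t) (M.dφ t) * M.g t X Y
        - M.V (M.φ t) * M.g t X Y + M.C (M.φ t) * M.T t X Y) := by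
    congr 1
    ext X Y
    exact hM.einstein t ht X Y
  simp only [metricTrace_add, metricTrace_sub, metricTrace_const_mul] at h1
  have h2 : metricTrace (M.g t) (fun X Y => M.dφ t X * M.dφ t Y) =
    covectorSq (M.g t) (M.dφ t) := rfl
  have h3 : metricTrace (M.g t) (fun X Y => M.T t X Y) = M.trT t := rfl
  have h4 : metricTrace (M.g t) (fun X Y => ricci M.I (dt 𝔤) M.g X Y t) =
    scalarCurv M.I (dt 𝔤) M.g t := rfl
  rw [h2, h3, h4, trT_eq ht, covectorSq_dφ ht, metricTrace_g ht] at h1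
  linarith

/-- The Raychaudhuri equation. -/
theorem hasDerivWithinAt_H :
    HasDerivWithinAt M.H ((-(M.dim * M.shearSq t) - M.dim * M.φdot t ^ 2 + M.spatialCurv t
      - M.C (M.φ t) * (M.dim * M.ρ t + M.trS t)) / (M.dim * (M.dim - 1))) M.I t := by
  have hd : 3 ≤ M.dim := by simp only [dim]; exact_mod_cast hn
  have h0 := ((hasDerivWithinAt_trace_k ht).neg.div_const M.dim)
  refine h0.congr_deriv ?_
  have h1 := ricci_dt ht
  have h2 := metricTrace_einstein ht hM
  have h3 := scalarCurv_spacetime ht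
  have h4 := hamiltonian_constraint ht hn hM
  rw [trace_k (by omega)] at h3
  rw [shearSq_eq ht (by omega)] at h1 h3 ⊢
  have h5 : M.dim ≠ 0 := by linarith
  have h6 : M.dim - 1 ≠ 0 := by linarith
  rw [div_eq_div_iff h5 (mul_ne_zero h5 h6)]
  rw [h1] at h3
  rw [h3] at h2
  -- The trace of the Einstein equation determines the trace of the derivative of `k`; adding this
  -- multiple of the constraint removes the potential.
  linear_combination (-M.dim / 2) * h2 - (M.dim / 2) * (M.dim + 1) * h4

theorem hasDerivWithinAt_φdot :
    HasDerivWithinAt M.φdot (-(M.dim * M.H t * M.φdot t) - M.V' (M.φ t)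
      + M.c (M.φ t) * M.trT t) M.I t := by
  have h1 : ContDiffOn ℝ 1 M.φdot M.I := M.φ_contDiff.derivWithin M.uniqueDiff_I (by norm_num)
  refine (h1.differentiableOn (by norm_num) t ht).hasDerivWithinAt.congr_deriv ?_
  have h2 := hM.scalar t ht
  rw [box_eq ht (by omega)] at h2
  linarith

end Equations

end Model

/-! ### Two decay criteria, and the reduced system of ordinary differential equations. -/

/-- A function with bounded derivative whose square is dominated by the decay rate of a convergent
function tends to zero. -/
theorem tendsto_zero_of_sq_le_neg_deriv {p p' h h' : ℝ → ℝ} {t₀ a K L : ℝ} (ha : 0 < a)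
    (hp : ∀ t, t₀ < t → HasDerivAt p (p' t) t) (hp' : ∀ t, t₀ < t → |p' t| ≤ K)
    (hh : ∀ t, t₀ < t → HasDerivAt h (h' t) t) (hh' : ∀ t, t₀ < t → h' t ≤ -(a * p t ^ 2))
    (hL : Tendsto h atTop (𝓝 L)) : Tendsto p atTop (𝓝 0) := by
  rw [Metric.tendsto_atTop]
  intro ε hε
  obtain ⟨K', hK', hKK⟩ : ∃ K', 0 < K' ∧ K ≤ K' := ⟨max K 1, by positivity, le_max_left _ _⟩
  -- If |p t| ≥ ε, then |p| ≥ ε/2 for a time `δ`, during which `h` drops by at least `m * δ`. Near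
  -- its limit, `h` varies by less than that.
  set δ := ε / (2 * K') with hδ
  have hδ0 : 0 < δ := by positivity
  set m := a * (ε / 2) ^ 2 with hm
  have hm0 : 0 < m := by positivity
  obtain ⟨T, hT⟩ := Metric.tendsto_atTop.mp hL (m * δ / 2) (by positivity)
  refine ⟨max T (t₀ + 1), fun t ht => ?_⟩
  have ht1 : T ≤ t := le_trans (le_max_left _ _) ht
  have ht2 : t₀ < t := lt_of_lt_of_le (by linarith) (le_trans (le_max_right _ _) ht)
  by_contra hcon
  rw [Real.dist_eq, sub_zero, not_lt] at hcon
  have h1 : ∀ s ∈ Icc t (t + δ), ε / 2 ≤ |p s| := by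
    intro s hs
    have h2 := (convex_Icc t (t + δ)).norm_image_sub_le_of_norm_hasDerivWithin_le (f := p) (C := K')
      (fun x hx => (hp x (by linarith [hx.1])).hasDerivWithinAt)
      (fun x hx => (hp' x (by linarith [hx.1])).trans hKK)
      (left_mem_Icc.mpr (by linarith)) hs
    rw [Real.norm_eq_abs, Real.norm_eq_abs, abs_of_nonneg (by linarith [hs.1] : 0 ≤ s - t)] at h2
    have h3 : K' * (s - t) ≤ ε / 2 := by
      calc K' * (s - t) ≤ K' * δ := by gcongr; linarith [hs.2]
        _ = ε / 2 := by rw [hδ]; field_simp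
    have h4 := abs_sub_abs_le_abs_sub (p t) (p s)
    rw [abs_sub_comm] at h4
    linarith
  have h5 : AntitoneOn (fun s => h s + m * s) (Icc t (t + δ)) := by
    refine antitoneOn_of_hasDerivWithinAt_nonpos (f' := fun s => h' s + m * 1) (convex_Icc _ _)
      ?_ ?_ ?_
    · intro s hs
      exact ((hh s (by linarith [hs.1])).continuousAt.add (by fun_prop)).continuousWithinAt
    · intro s hs
      rw [interior_Icc] at hs
      exact ((hh s (by linarith [hs.1])).add ((hasDerivAt_id s).const_mul m)).hasDerivWithinAt
    · intro s hs
      rw [interior_Icc] at hs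
      have h6 := hh' s (by linarith [hs.1])
      have h7 := h1 s ⟨hs.1.le, hs.2.le⟩
      have h8 : (ε / 2) ^ 2 ≤ p s ^ 2 := by
        rw [← sq_abs (p s)]; gcongr
      have h9 : m ≤ a * p s ^ 2 := by rw [hm]; gcongr
      linarith
  have h10 := h5 (left_mem_Icc.mpr (by linarith)) (right_mem_Icc.mpr (by linarith))
    (by linarith : t ≤ t + δ)
  have h11 := abs_lt.mp (hT t ht1)
  have h12 := abs_lt.mp (hT (t + δ) (by linarith))
  simp only at h10
  nlinarith [h11.1, h11.2, h12.1, h12.2]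

/-- A nonnegative function with `f' ≤ -a f` tends to zero. -/
theorem tendsto_zero_of_deriv_le_neg_mul {f f' : ℝ → ℝ} {T a : ℝ} (ha : 0 < a)
    (hf : ∀ t, T ≤ t → HasDerivAt f (f' t) t) (hf' : ∀ t, T ≤ t → f' t ≤ -(a * f t))
    (h0 : ∀ t, T ≤ t → 0 ≤ f t) : Tendsto f atTop (𝓝 0) := by
  have h1 : ∀ t, T ≤ t → HasDerivAt (fun s => f s * Real.exp (a * s))
      (f' t * Real.exp (a * t) + f t * (Real.exp (a * t) * (a * 1))) t := fun t ht =>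
    (hf t ht).mul (((hasDerivAt_id t).const_mul a).exp)
  have h2 : AntitoneOn (fun s => f s * Real.exp (a * s)) (Ici T) := by
    refine antitoneOn_of_hasDerivWithinAt_nonpos (convex_Ici T)
      (fun t ht => (h1 t ht).continuousAt.continuousWithinAt)
      (fun t ht => (h1 t (interior_subset ht)).hasDerivWithinAt) fun t ht => ?_
    have h3 := hf' t (interior_subset ht)
    have h4 := Real.exp_pos (a * t)
    nlinarith
  have h5 : ∀ t, T ≤ t → f t ≤ f T * Real.exp (a * T) * Real.exp (-(a * t)) := by
    intro t ht
    have h6 := h2 self_mem_Ici ht ht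
    simp only at h6
    rw [Real.exp_neg, ← div_eq_mul_inv, le_div_iff₀ (Real.exp_pos _)]
    exact h6
  have h7 : Tendsto (fun t => f T * Real.exp (a * T) * Real.exp (-(a * t))) atTop (𝓝 0) := by
    have h8 : Tendsto (fun t => Real.exp (-(a * t))) atTop (𝓝 0) :=
      Real.tendsto_exp_neg_atTop_nhds_zero.comp (tendsto_id.const_mul_atTop ha)
    simpa using h8.const_mul (f T * Real.exp (a * T))
  exact squeeze_zero' ((eventually_ge_atTop T).mono h0) ((eventually_ge_atTop T).mono h5) h7

/-- The time derivative of the expansion, by the Raychaudhuri equation. -/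
noncomputable def raychaudhuri (d : ℝ) (p q R r s : ℝ → ℝ) (t : ℝ) : ℝ :=
  (-(d * q t) - d * p t ^ 2 + R t - (d * r t + s t)) / (d * (d - 1))

/-- The equations for the expansion `H`, the velocity `p` of the scalar field and the potential
energy `v`, where `w` is the slope of the potential, `q` the squared shear, `R` the spatial
curvature, `r` and `s` the effective energy density and pressure trace of the matter, and `e` the
coupling term. -/
structure ReducedSystem (d t₀ C₁ : ℝ) (H p v w q R r s e : ℝ → ℝ) : Prop where
  dim : 3 ≤ d
  C₁_nonneg : 0 ≤ C₁
  H_init : 0 < H t₀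
  v_pos : ∀ t ∈ Ici t₀, 0 < v t
  q_nonneg : ∀ t ∈ Ici t₀, 0 ≤ q t
  R_nonpos : ∀ t ∈ Ici t₀, R t ≤ 0
  r_nonneg : ∀ t ∈ Ici t₀, 0 ≤ r t
  s_le : ∀ t ∈ Ici t₀, |s t| ≤ d * r t
  s_ge : ∀ t ∈ Ici t₀, 0 ≤ r t + s t
  e_le : ∀ t ∈ Ici t₀, |e t| ≤ C₁ * r t
  constraint : ∀ t ∈ Ici t₀, d * (d - 1) * H t ^ 2 + R t = q t + p t ^ 2 + 2 * v t + 2 * r t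
  deriv_H : ∀ t ∈ Ici t₀, HasDerivWithinAt H (raychaudhuri d p q R r s t) (Ici t₀) t
  deriv_p : ∀ t ∈ Ici t₀, HasDerivWithinAt p (-(d * H t * p t) - w t + e t) (Ici t₀) t
  deriv_v : ∀ t ∈ Ici t₀, HasDerivWithinAt v (w t * p t) (Ici t₀) t

namespace ReducedSystem

variable {d t₀ C₁ : ℝ} {H p v w q R r s e : ℝ → ℝ} (h : ReducedSystem d t₀ C₁ H p v w q R r s e)

include h

theorem dim_mul_pos : 0 < d * (d - 1) := by
  have := h.dim
  nlinarith

theorem H_pos : ∀ t ∈ Ici t₀, 0 < H t := by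
  have hne : ∀ t ∈ Ici t₀, H t ≠ 0 := by
    intro t ht h0
    have h1 := h.constraint t ht
    rw [h0] at h1
    nlinarith [h.v_pos t ht, h.q_nonneg t ht, h.R_nonpos t ht, h.r_nonneg t ht, sq_nonneg (p t)]
  intro t ht
  by_contra hcon
  have h1 : ContinuousOn H (Icc t₀ t) := fun x hx =>
    (h.deriv_H x hx.1).continuousWithinAt.mono Icc_subset_Ici_self
  obtain ⟨x, hx, hx0⟩ := intermediate_value_Icc' ht h1 ⟨not_lt.mp hcon, h.H_init.le⟩
  exact hne x hx.1 hx0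

theorem hasDerivAt_H {t : ℝ} (ht : t₀ < t) : HasDerivAt H (raychaudhuri d p q R r s t) t :=
  (h.deriv_H t ht.le).hasDerivAt (Ici_mem_nhds ht)

/-- The part of the expansion that is due neither to the scalar field nor to its potential. -/
theorem excess_eq {t : ℝ} (ht : t ∈ Ici t₀) :
    d * (d - 1) * H t ^ 2 - p t ^ 2 - 2 * v t = q t - R t + 2 * r t := by
  linarith [h.constraint t ht]

/-- Here the dimension matters: d r + s = (d - 1) r + (r + s) ≥ 2 r because d ≥ 3. -/
theorem raychaudhuri_le {t : ℝ} (ht : t ∈ Ici t₀) :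
    raychaudhuri d p q R r s t ≤ -((q t - R t + 2 * r t + p t ^ 2) / (d * (d - 1))) := by
  rw [raychaudhuri, ← neg_div]
  have h0 := h.dim_mul_pos
  gcongr
  nlinarith [h.dim, h.q_nonneg t ht, h.r_nonneg t ht, h.s_ge t ht, sq_nonneg (p t)]

/-- Eliminating q + p² by the constraint leaves -d H² plus the nonnegative terms (1 - d) R, 2 d v
and d r - s, each divided by d (d - 1). -/
theorem raychaudhuri_ge {t : ℝ} (ht : t ∈ Ici t₀) :
    -(d * H t ^ 2) ≤ raychaudhuri d p q R r s t := by
  rw [raychaudhuri, le_div_iff₀ h.dim_mul_pos]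
  have h1 := h.constraint t ht
  have h2 := (abs_le.mp (h.s_le t ht)).2
  have h3 : d * (d * (d - 1) * H t ^ 2 + R t) = d * (q t + p t ^ 2 + 2 * v t + 2 * r t) := by
    rw [h1]
  nlinarith [h.dim, h.v_pos t ht, h.R_nonpos t ht]

theorem antitoneOn_H : AntitoneOn H (Ici t₀) := by
  refine antitoneOn_of_hasDerivWithinAt_nonpos (convex_Ici t₀)
    (fun t ht => (h.deriv_H t ht).continuousWithinAt)
    (fun t ht => (h.deriv_H t (interior_subset ht)).mono interior_subset) fun t ht => ?_
  have ht := interior_subset ht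
  refine (h.raychaudhuri_le ht).trans (neg_nonpos.mpr (div_nonneg ?_ h.dim_mul_pos.le))
  nlinarith [h.q_nonneg t ht, h.R_nonpos t ht, h.r_nonneg t ht, sq_nonneg (p t)]

theorem exists_limit : ∃ L, 0 ≤ L ∧ Tendsto H atTop (𝓝 L) ∧ ∀ t ∈ Ici t₀, L ≤ H t := by
  -- Freezing `H` before `t₀` makes it monotone on the whole line.
  have h1 : Antitone fun t => H (max t₀ t) := fun a b hab =>
    h.antitoneOn_H (mem_Ici.mpr (le_max_left _ _)) (mem_Ici.mpr (le_max_left _ _)) (max_le_max_left _ hab)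
  have h2 : ∀ t, 0 ≤ H (max t₀ t) := fun t => (h.H_pos _ (mem_Ici.mpr (le_max_left _ _))).le
  have h3 : BddBelow (range fun t => H (max t₀ t)) := ⟨0, by rintro _ ⟨t, rfl⟩; exact h2 t⟩
  refine ⟨⨅ t, H (max t₀ t), le_ciInf h2, ?_, fun t ht => ?_⟩
  · refine (tendsto_atTop_ciInf h1 h3).congr' ?_
    filter_upwards [eventually_ge_atTop t₀] with t ht
    rw [max_eq_right ht]
  · have := ciInf_le h3 t
    rwa [max_eq_right ht] at this

theorem tendsto_of_pos_limit {L : ℝ} (hL : 0 < L) (hHL : Tendsto H atTop (𝓝 L))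
    (hLH : ∀ t ∈ Ici t₀, L ≤ H t) {W : ℝ} (hW : ∀ t ∈ Ici t₀, |w t| ≤ W) :
    Tendsto (fun t => p t / H t) atTop (𝓝 0) ∧
      Tendsto (fun t => (q t - R t + 2 * r t) / H t ^ 2) atTop (𝓝 0) := by
  have hd := h.dim_mul_pos
  have hH0 : ∀ t ∈ Ici t₀, H t ≤ H t₀ := fun t ht => h.antitoneOn_H self_mem_Ici ht ht
  have hHsq : ∀ t ∈ Ici t₀, H t ^ 2 ≤ H t₀ ^ 2 := fun t ht =>
    pow_le_pow_left₀ (h.H_pos t ht).le (hH0 t ht) 2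
  set N := d * (d - 1) * H t₀ ^ 2 with hN
  have hcN : ∀ t ∈ Ici t₀, q t - R t + 2 * r t + p t ^ 2 + 2 * v t ≤ N := by
    intro t ht
    have h1 : d * (d - 1) * H t ^ 2 ≤ N := by
      rw [hN]
      exact mul_le_mul_of_nonneg_left (hHsq t ht) hd.le
    linarith [h.constraint t ht]
  have hp : Tendsto p atTop (𝓝 0) := by
    refine tendsto_zero_of_sq_le_neg_deriv (a := 1 / (d * (d - 1)))
      -- One summand for each term of the equation for `p`; `N + 1` bounds |p| because p² ≤ N.
      (K := d * H t₀ * (N + 1) + W + C₁ * N) (by positivity)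
      (fun t ht => (h.deriv_p t ht.le).hasDerivAt (Ici_mem_nhds ht)) ?_
      (fun t ht => h.hasDerivAt_H ht) ?_ hHL
    · intro t ht
      have ht : t ∈ Ici t₀ := ht.le
      have h1 := hcN t ht
      have h2 : p t ^ 2 ≤ N := by
        nlinarith [h.q_nonneg t ht, h.R_nonpos t ht, h.r_nonneg t ht, h.v_pos t ht]
      have h3 : r t ≤ N := by
        nlinarith [h.q_nonneg t ht, h.R_nonpos t ht, h.r_nonneg t ht, h.v_pos t ht,
          sq_nonneg (p t)]
      have h4 : |p t| ≤ N + 1 := by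
        rw [← sq_abs] at h2
        nlinarith [abs_nonneg (p t)]
      have h5 : |d * H t * p t| ≤ d * H t₀ * (N + 1) := by
        rw [abs_mul, abs_mul, abs_of_nonneg (by linarith [h.dim] : 0 ≤ d),
          abs_of_pos (h.H_pos t ht)]
        have := h.dim
        have := h.H_init
        gcongr
        exact hH0 t ht
      have h6 : |e t| ≤ C₁ * N := (h.e_le t ht).trans (by have := h.C₁_nonneg; gcongr)
      have h7 := abs_le.mp h5
      have h8 := abs_le.mp h6
      have h9 := abs_le.mp (hW t ht)
      rw [abs_le]
      constructor <;> linarith [h7.1, h7.2, h8.1, h8.2, h9.1, h9.2]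
    · intro t ht
      have ht : t ∈ Ici t₀ := ht.le
      refine (h.raychaudhuri_le ht).trans ?_
      rw [one_div_mul_eq_div]
      gcongr
      linarith [h.q_nonneg t ht, h.R_nonpos t ht, h.r_nonneg t ht]
  -- Differentiation gives -2H(d q - R + d r + s) - 2 p e. Once C₁|p| ≤ L, the coupling term costs
  -- at most 2 L r, half of the available damping of `r`.
  have hZ : Tendsto (fun t => d * (d - 1) * H t ^ 2 - p t ^ 2 - 2 * v t) atTop (𝓝 0) := by
    have h1 : ∀ᶠ t in atTop, C₁ * |p t| ≤ L := by
      have h2 : Tendsto (fun t => C₁ * |p t|) atTop (𝓝 0) := by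
        simpa using hp.abs.const_mul C₁
      exact h2.eventually (eventually_le_nhds hL)
    obtain ⟨T, hT⟩ := (h1.and (eventually_gt_atTop t₀)).exists_forall_of_atTop
    refine tendsto_zero_of_deriv_le_neg_mul (T := T) hL (fun t ht => by
      have ht0 := (hT t ht).2
      exact ((((h.hasDerivAt_H ht0).pow 2).const_mul (d * (d - 1))).sub
        (((h.deriv_p t ht0.le).hasDerivAt (Ici_mem_nhds ht0)).pow 2)).sub
        (((h.deriv_v t ht0.le).hasDerivAt (Ici_mem_nhds ht0)).const_mul 2)) ?_ ?_
    · intro t ht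
      obtain ⟨h2, h3⟩ := hT t ht
      have ht : t ∈ Ici t₀ := h3.le
      rw [h.excess_eq ht]
      have h4 : d * (d - 1) * raychaudhuri d p q R r s t =
          -(d * q t) - d * p t ^ 2 + R t - (d * r t + s t) := by
        rw [raychaudhuri, mul_div_cancel₀ _ hd.ne']
      have h5 := hLH t ht
      have h6 : |p t * e t| ≤ L * r t := by
        rw [abs_mul]
        calc |p t| * |e t| ≤ |p t| * (C₁ * r t) := by gcongr; exact h.e_le t ht
          _ = C₁ * |p t| * r t := by ring
          _ ≤ L * r t := by have := h.r_nonneg t ht; gcongr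
      have h7 : L * (q t - R t + 2 * r t) ≤ H t * (d * q t - R t + d * r t + s t) := by
        have hdd := h.dim
        have hq := h.q_nonneg t ht
        have hr := h.r_nonneg t ht
        have hR := h.R_nonpos t ht
        have hs := h.s_ge t ht
        have h8 : q t - R t + 2 * r t ≤ d * q t - R t + d * r t + s t := by nlinarith
        exact mul_le_mul h5 h8 (by linarith) (h.H_pos t ht).le
      have h9 := (abs_le.mp h6).1
      have h10 : 0 ≤ L * (q t - R t) :=
        mul_nonneg hL.le (by linarith [h.q_nonneg t ht, h.R_nonpos t ht])
      have h11 : 2 * H t * (d * (d - 1) * raychaudhuri d p q R r s t) =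
        2 * H t * (-(d * q t) - d * p t ^ 2 + R t - (d * r t + s t)) := by rw [h4]
      push_cast
      nlinarith
    · intro t ht
      have ht : t ∈ Ici t₀ := (hT t ht).2.le
      rw [h.excess_eq ht]
      linarith [h.q_nonneg t ht, h.R_nonpos t ht, h.r_nonneg t ht]
  constructor
  · have h1 := hp.div hHL hL.ne'
    rw [zero_div] at h1
    exact h1
  · have h1 := hZ.div (hHL.pow 2) (by positivity)
    rw [zero_div] at h1
    refine h1.congr' ?_
    filter_upwards [eventually_ge_atTop t₀] with t ht
    simp only [Pi.div_apply, h.excess_eq ht]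

theorem tendsto_of_zero_limit (hH : Tendsto H atTop (𝓝 0))
    (hw : Tendsto (fun t => w t / v t) atTop (𝓝 0)) :
    Tendsto (fun t => p t / H t) atTop (𝓝 0) ∧
      Tendsto (fun t => (q t - R t + 2 * r t) / H t ^ 2) atTop (𝓝 0) := by
  have hd := h.dim
  set N := d * (d - 1) with hN
  have hN1 : 1 ≤ N := by nlinarith
  set y : ℝ → ℝ := fun t => (q t - R t + 2 * r t + p t ^ 2) / H t ^ 2 with hy
  set u : ℝ → ℝ := fun t => v t / H t ^ 2 with hu
  have hyu : ∀ t ∈ Ici t₀, y t = N - 2 * u t := by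
    intro t ht
    have := (h.H_pos t ht).ne'
    simp only [hy, hu]
    field_simp
    linarith [h.constraint t ht]
  have hy0 : ∀ t ∈ Ici t₀, 0 ≤ y t := fun t ht => by
    have : 0 ≤ q t - R t + 2 * r t + p t ^ 2 := by
      nlinarith [h.q_nonneg t ht, h.R_nonpos t ht, h.r_nonneg t ht, sq_nonneg (p t)]
    positivity
  have hu0 : ∀ t ∈ Ici t₀, 0 < u t := fun t ht => by
    have := h.v_pos t ht
    have := h.H_pos t ht
    positivity
  set u' : ℝ → ℝ := fun t => (w t * p t * H t ^ 2 -
    v t * (2 * H t * raychaudhuri d p q R r s t)) / (H t ^ 2) ^ 2 with hu'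
  have hud : ∀ t, t₀ < t → HasDerivAt u (u' t) t := by
    intro t ht
    have h1 := ((h.deriv_v t ht.le).hasDerivAt (Ici_mem_nhds ht)).div ((h.hasDerivAt_H ht).pow 2)
      (pow_ne_zero 2 (h.H_pos t ht.le).ne')
    refine h1.congr_deriv ?_
    simp [hu']
  -- In u'/u, the decay of `H` contributes at least 2(δ/N)H when y ≥ δ. Since |p| ≤ N H, slope |w/v|
  -- ≤ δ/N² costs at most half of this.
  have hgrowth : ∀ δ > 0, ∀ᶠ t in atTop, t₀ < t ∧ (δ ≤ y t → δ / N * H t * u t ≤ u' t) := by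
    intro δ hδ
    have h1 : ∀ᶠ t in atTop, |w t / v t| ≤ δ / N ^ 2 := by
      have h2 := hw.abs
      rw [abs_zero] at h2
      exact h2.eventually (eventually_le_nhds (by positivity))
    filter_upwards [h1, eventually_gt_atTop t₀] with t ht1 ht2
    refine ⟨ht2, fun hyt => ?_⟩
    have ht : t ∈ Ici t₀ := ht2.le
    have hHp := h.H_pos t ht
    have hvp := h.v_pos t ht
    have hup := hu0 t ht
    have hpH : |p t| ≤ N * H t := by
      refine abs_le_of_sq_le_sq ?_ (by positivity)
      have h3 : N * H t ^ 2 ≤ N * (N * H t ^ 2) :=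
        le_mul_of_one_le_left (by positivity) hN1
      nlinarith [h.constraint t ht, h.q_nonneg t ht, h.R_nonpos t ht, h.r_nonneg t ht]
    have h3 : |w t * p t| ≤ δ / N * H t * v t := by
      calc |w t * p t| = |w t / v t| * v t * |p t| := by
            rw [abs_mul, abs_div, abs_of_pos hvp]; field_simp
        _ ≤ δ / N ^ 2 * v t * (N * H t) := by gcongr
        _ = δ / N * H t * v t := by field_simp
    have h4 : raychaudhuri d p q R r s t ≤ -(δ / N * H t ^ 2) := by
      refine (h.raychaudhuri_le ht).trans (neg_le_neg ?_)
      rw [← hN, div_mul_eq_mul_div]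
      gcongr
      rwa [hy, le_div_iff₀ (by positivity)] at hyt
    have h5 := (abs_le.mp h3).1
    have h6 : δ / N * H t * u t = δ / N * H t * v t * H t ^ 2 / (H t ^ 2) ^ 2 := by
      simp only [hu]; field_simp
    rw [h6, hu']
    refine div_le_div_of_nonneg_right ?_ (by positivity)
    have h7 : v t * (2 * H t * raychaudhuri d p q R r s t) ≤
        v t * (2 * H t * -(δ / N * H t ^ 2)) := by gcongr
    have h8 : -(δ / N * H t * v t) * H t ^ 2 ≤ w t * p t * H t ^ 2 := by gcongr
    linarith
  have hsmall : ∀ δ > 0, ∃ᶠ t in atTop, y t < δ := by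
    intro δ hδ hcon
    obtain ⟨T, hT⟩ := ((hgrowth δ hδ).and hcon).exists_forall_of_atTop
    set κ := δ / N with hκ
    have hκ0 : 0 < κ := by positivity
    -- The weight κ/d is chosen so that H'/H ≥ -d H exactly offsets the growth rate κ H of log u.
    -- But log u ≤ log N while log H → -∞, a contradiction.
    have h1 : MonotoneOn (fun t => Real.log (u t) + κ / d * Real.log (H t)) (Ici T) := by
      have hder : ∀ t ∈ Ici T, HasDerivAt (fun t => Real.log (u t) + κ / d * Real.log (H t))
          (u' t / u t + κ / d * (raychaudhuri d p q R r s t / H t)) t := fun t ht => by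
        have ht0 := (hT t ht).1.1
        exact ((hud t ht0).log (hu0 t ht0.le).ne').add
          (((h.hasDerivAt_H ht0).log (h.H_pos t ht0.le).ne').const_mul _)
      refine monotoneOn_of_hasDerivWithinAt_nonneg (convex_Ici T)
        (fun t ht => (hder t ht).continuousAt.continuousWithinAt)
        (fun t ht => (hder t (interior_subset ht)).hasDerivWithinAt) fun t ht => ?_
      obtain ⟨⟨h2, h3⟩, h4⟩ := hT t (interior_subset ht)
      have ht : t ∈ Ici t₀ := h2.le
      have h5 := h3 (not_lt.mp h4)
      have h6 : κ * H t ≤ u' t / u t := by rwa [le_div_iff₀ (hu0 t ht)]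
      have h7 : -(d * H t) ≤ raychaudhuri d p q R r s t / H t := by
        rw [le_div_iff₀ (h.H_pos t ht)]
        linarith [h.raychaudhuri_ge ht]
      have h8 : κ / d * -(d * H t) ≤ κ / d * (raychaudhuri d p q R r s t / H t) := by gcongr
      have h9 : κ / d * -(d * H t) = -(κ * H t) := by field_simp
      linarith
    have h2 : Tendsto (fun t => Real.log N + κ / d * Real.log (H t)) atTop atBot := by
      refine tendsto_atBot_add_const_left _ _ (Tendsto.const_mul_atBot (by positivity) ?_)
      refine Real.tendsto_log_nhdsGT_zero.comp (tendsto_nhdsWithin_iff.mpr ⟨hH, ?_⟩)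
      filter_upwards [eventually_ge_atTop t₀] with t ht using h.H_pos t ht
    obtain ⟨t, h3, h4⟩ := ((h2.eventually (eventually_lt_atBot
      (Real.log (u T) + κ / d * Real.log (H T)))).and (eventually_ge_atTop T)).exists
    have h5 := h1 self_mem_Ici h4 h4
    have ht0 : t ∈ Ici t₀ := (hT t h4).1.1.le
    have h6 : Real.log (u t) ≤ Real.log N :=
      Real.log_le_log (hu0 t ht0) (by linarith [hyu t ht0, hy0 t ht0, hu0 t ht0])
    simp only at h5
    linarith
  have hy_tendsto : Tendsto y atTop (𝓝 0) := by
    rw [Metric.tendsto_atTop]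
    intro ε hε
    have hδ : 0 < ε / 2 := by linarith
    obtain ⟨T, hT⟩ := (hgrowth _ hδ).exists_forall_of_atTop
    obtain ⟨t₁, ht₁, hyt₁⟩ := (frequently_atTop.mp (hsmall _ hδ)) T
    refine ⟨t₁, fun t ht => ?_⟩
    -- Barrier argument: y = ε/2 corresponds to u = (N - ε/2)/2, and there u' > 0, so `y` cannot
    -- climb back above ε/2 after `t₁`.
    have h1 : -u t ≤ -((N - ε / 2) / 2) := by
      refine image_le_of_deriv_right_lt_deriv_boundary' (f := fun x => -u x) (f' := fun x => -u' x)
        (B := fun _ => -((N - ε / 2) / 2)) (B' := fun _ => 0) (a := t₁) (b := t) ?_ ?_ ?_ ?_ ?_ ?_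
        (right_mem_Icc.mpr ht)
      · exact fun x hx => (hud x (hT x (ht₁.trans hx.1)).1).continuousAt.neg.continuousWithinAt
      · exact fun x hx => (hud x (hT x (ht₁.trans hx.1)).1).neg.hasDerivWithinAt
      · have := hyu t₁ (hT t₁ ht₁).1.le
        linarith
      · exact continuousOn_const
      · exact fun x _ => hasDerivWithinAt_const _ _ _
      · intro x hx hxe
        obtain ⟨h2, h3⟩ := hT x (ht₁.trans hx.1)
        have h4 := h3 (by linarith [hyu x h2.le])
        have h5 := h.H_pos x h2.le
        have h6 := hu0 x h2.le
        have h7 : 0 < ε / 2 / N * H x * u x := by positivity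
        linarith
    have ht0 : t ∈ Ici t₀ := (hT t (ht₁.trans ht)).1.le
    rw [Real.dist_eq, sub_zero, abs_of_nonneg (hy0 t ht0)]
    linarith [hyu t ht0]
  constructor
  · have h1 : Tendsto (fun t => (p t / H t) ^ 2) atTop (𝓝 0) := by
      refine squeeze_zero' (.of_forall fun _ => sq_nonneg _) ?_ hy_tendsto
      filter_upwards [eventually_ge_atTop t₀] with t ht
      simp only [hy, div_pow]
      gcongr
      linarith [h.q_nonneg t ht, h.R_nonpos t ht, h.r_nonneg t ht]
    have h2 := h1.sqrt
    simp only [Real.sqrt_sq_eq_abs, Real.sqrt_zero] at h2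
    exact (tendsto_zero_iff_abs_tendsto_zero _).mpr h2
  · refine squeeze_zero' ?_ ?_ hy_tendsto
    · filter_upwards [eventually_ge_atTop t₀] with t ht
      have : 0 ≤ q t - R t + 2 * r t := by
        linarith [h.q_nonneg t ht, h.R_nonpos t ht, h.r_nonneg t ht]
      positivity
    · filter_upwards [eventually_ge_atTop t₀] with t ht
      simp only [hy]
      refine div_le_div_of_nonneg_right ?_ (sq_nonneg _)
      linarith [sq_nonneg (p t)]

end ReducedSystem

/-! ### From the model to the reduced system, and the conclusion. -/

namespace Model

variable {𝔤 : Type*} [LieRing 𝔤] [LieAlgebra ℝ 𝔤] [FiniteDimensional ℝ 𝔤] {M : Model 𝔤}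

theorem EnergyConditions.ρ_nonneg (hT : M.EnergyConditions) {t : ℝ} (ht : t ∈ M.I) : 0 ≤ M.ρ t :=
  (Real.sqrt_nonneg _).trans (hT.dec_flow t ht)

theorem CouplingConditions.exists_nonneg_bound (hC : M.CouplingConditions) :
    ∃ C₀ : ℝ, 0 ≤ C₀ ∧ ∀ x ∈ M.J, |M.c x| ≤ C₀ * M.C x := by
  obtain ⟨C₀, h⟩ := hC.bound
  refine ⟨max C₀ 0, le_max_right _ _, fun x hx => (h x hx).trans ?_⟩
  exact mul_le_mul_of_nonneg_right (le_max_left _ _) (hC.nonneg x hx)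

theorem exists_reducedSystem (hn : 3 ≤ Module.finrank ℝ 𝔤)
    (hG : ∀ h : LinearMap.BilinForm ℝ 𝔤, IsRiemannian h → groupScalarCurv h ≤ 0)
    (hM : M.SolvesESM) (hT : M.EnergyConditions) (hC : M.CouplingConditions)
    (hV : M.PotentialConditions) (hH : 0 < M.H M.t₀) :
    ∃ C₁, ReducedSystem M.dim M.t₀ C₁ M.H M.φdot (fun t => M.V (M.φ t)) (fun t => M.V' (M.φ t))
      M.shearSq M.spatialCurv (fun t => M.C (M.φ t) * M.ρ t) (fun t => M.C (M.φ t) * M.trS t)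
      (fun t => M.c (M.φ t) * M.trT t) := by
  obtain ⟨C₀, hC₀, hc⟩ := hC.exists_nonneg_bound
  have hd : 3 ≤ M.dim := by simp only [dim]; exact_mod_cast hn
  -- The factor n + 1 comes from |tr_g T| ≤ |tr_γ S| + ρ ≤ (n + 1)ρ.
  refine ⟨C₀ * (M.dim + 1), hd, by positivity, hH, fun t ht => hV.pos _ (M.φ_mem t ht),
    fun t ht => shearSq_nonneg ht, fun t ht => hG _ (M.γ_riemannian t ht),
    fun t ht => mul_nonneg (hC.nonneg _ (M.φ_mem t ht)) (hT.ρ_nonneg ht), fun t ht => ?_,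
    fun t ht => ?_, fun t ht => ?_, fun t ht => hamiltonian_constraint ht hn hM, fun t ht => ?_,
    fun t ht => ?_, fun t ht => ?_⟩
  · have h0 := hC.nonneg _ (M.φ_mem t ht)
    rw [abs_mul, abs_of_nonneg h0, mul_left_comm]
    exact mul_le_mul_of_nonneg_left (hT.dec_pressure t ht) h0
  · rw [← mul_add]
    exact mul_nonneg (hC.nonneg _ (M.φ_mem t ht)) (hT.sec t ht)
  · have h0 := hC.nonneg _ (M.φ_mem t ht)
    have h1 := hT.dec_pressure t ht
    have h2 := hT.ρ_nonneg ht
    have h3 : |M.trT t| ≤ (M.dim + 1) * M.ρ t := by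
      rw [trT_eq ht]
      have := abs_le.mp h1
      rw [abs_le]
      constructor <;> linarith [this.1, this.2]
    calc |M.c (M.φ t) * M.trT t| = |M.c (M.φ t)| * |M.trT t| := abs_mul _ _
      _ ≤ (C₀ * M.C (M.φ t)) * ((M.dim + 1) * M.ρ t) :=
        mul_le_mul (hc _ (M.φ_mem t ht)) h3 (abs_nonneg _) (mul_nonneg hC₀ h0)
      _ = C₀ * (M.dim + 1) * (M.C (M.φ t) * M.ρ t) := by ring
  · refine (hasDerivWithinAt_H ht hn hM).congr_deriv ?_
    rw [raychaudhuri]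
    ring
  · exact hasDerivWithinAt_φdot ht hn hM
  · have h1 := ((M.V_contDiff.differentiableOn (by norm_num)) _ (M.φ_mem t ht)).hasDerivWithinAt
    have h2 := ((M.φ_contDiff.differentiableOn (by norm_num)) t ht).hasDerivWithinAt
    exact h1.comp t h2 fun s hs => M.φ_mem s hs

/-- If the potential energy decays, the scalar field leaves every bounded set. -/
theorem tendsto_abs_φ_of_tendsto_V (hV : M.PotentialConditions)
    (h0 : Tendsto (fun t => M.V (M.φ t)) atTop (𝓝 0)) :
    Tendsto (fun t => |M.φ t|) atTop atTop := by
  obtain ⟨Vb, hlsc, hpos, hle⟩ := hV.minorant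
  rw [tendsto_atTop]
  intro B
  set K := closure M.J ∩ Icc (-B) B with hK
  -- Points of the closure of J outside J must be included for compactness; this is why the positive
  -- minorant lives on the closure.
  have hKc : IsCompact K := isCompact_Icc.inter_left isClosed_closure
  have hm : ∃ m > 0, ∀ x ∈ K, m ≤ Vb x := by
    rcases K.eq_empty_or_nonempty with h1 | h1
    · exact ⟨1, one_pos, fun x hx => by simp [h1] at hx⟩
    · obtain ⟨a, ha, hmin⟩ := (hlsc.mono inter_subset_left).exists_isMinOn h1 hKc
      exact ⟨Vb a, hpos a ha.1, fun x hx => hmin hx⟩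
  obtain ⟨m, hm0, hm⟩ := hm
  filter_upwards [h0.eventually (eventually_lt_nhds hm0), eventually_ge_atTop M.t₀] with t h1 h2
  by_contra h3
  have h4 := abs_le.mp (not_le.mp h3).le
  have h5 := hm (M.φ t) ⟨subset_closure (M.φ_mem t h2), h4.1, h4.2⟩
  linarith [hle _ (M.φ_mem t h2)]

/-- Activates the normalization that excludes φ → -∞. -/
theorem V₀_eq_zero (hV : M.PotentialConditions)
    (h0 : Tendsto (fun t => M.V (M.φ t)) atTop (𝓝 0)) : M.V₀ = 0 := by
  have hb : ∀ y ∈ (fun t => M.V (M.φ t)) '' M.I, 0 ≤ y := by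
    rintro _ ⟨t, ht, rfl⟩
    exact (hV.pos _ (M.φ_mem t ht)).le
  refine le_antisymm (ge_of_tendsto h0 ?_) (Real.sInf_nonneg hb)
  filter_upwards [eventually_ge_atTop M.t₀] with t ht
  exact csInf_le ⟨0, hb⟩ ⟨t, ht, rfl⟩

/-- Once |φ| ≥ 1, continuity prevents a change of sign, so φ tends to one of the two infinities. -/
theorem tendsto_φ_atTop (habs : Tendsto (fun t => |M.φ t|) atTop atTop)
    (hφ : ¬ Tendsto M.φ atTop atBot) : Tendsto M.φ atTop atTop := by
  obtain ⟨T, hT⟩ := ((habs.eventually (eventually_ge_atTop 1)).and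
    (eventually_ge_atTop M.t₀)).exists_forall_of_atTop
  have hcont : ∀ t, ContinuousOn M.φ (Icc T t) := fun t =>
    M.φ_contDiff.continuousOn.mono fun s hs => (hT s hs.1).2
  have hne : ∀ t, T ≤ t → M.φ t ≠ 0 := fun t ht h0 => by
    have := (hT t ht).1
    rw [h0, abs_zero] at this
    linarith
  rcases lt_or_gt_of_ne (hne T le_rfl) with h1 | h1
  · refine absurd ?_ hφ
    rw [← tendsto_neg_atTop_iff]
    refine habs.congr' ?_
    filter_upwards [eventually_ge_atTop T] with t ht
    refine abs_of_nonpos ?_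
    by_contra hcon
    obtain ⟨x, hx, hx0⟩ := intermediate_value_Icc ht (hcont t) ⟨h1.le, (not_le.mp hcon).le⟩
    exact hne x hx.1 hx0
  · refine habs.congr' ?_
    filter_upwards [eventually_ge_atTop T] with t ht
    refine abs_of_nonneg ?_
    by_contra hcon
    obtain ⟨x, hx, hx0⟩ := intermediate_value_Icc' ht (hcont t) ⟨(not_le.mp hcon).le, h1.le⟩
    exact hne x hx.1 hx0

theorem late_time_asymptotics (hn : 3 ≤ Module.finrank ℝ 𝔤)
    (hG : ∀ h : LinearMap.BilinForm ℝ 𝔤, IsRiemannian h → groupScalarCurv h ≤ 0)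
    (hM : M.SolvesESM) (hT : M.EnergyConditions) (hC : M.CouplingConditions)
    (hV : M.PotentialConditions) (hH : 0 < M.H M.t₀)
    (hφ : M.V₀ = 0 → ¬ Tendsto M.φ atTop atBot) (hflat : M.FlatAtInfinity) :
    (∀ t, M.t₀ ≤ t → 0 < M.H t) ∧
    Tendsto (fun t => M.φdot t / M.H t) atTop (𝓝 0) ∧
    Tendsto (fun t => M.shearSq t / M.H t ^ 2) atTop (𝓝 0) ∧
    Tendsto (fun t => M.spatialCurv t / M.H t ^ 2) atTop (𝓝 0) ∧
    Tendsto (fun t => M.C (M.φ t) * M.ρ t / M.H t ^ 2) atTop (𝓝 0) ∧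
    Tendsto (fun t => M.C (M.φ t) * M.jNorm t / M.H t ^ 2) atTop (𝓝 0) ∧
    Tendsto (fun t => M.C (M.φ t) * M.trS t / M.H t ^ 2) atTop (𝓝 0) ∧
    Tendsto (fun t => M.c (M.φ t) * M.trT t / M.H t ^ 2) atTop (𝓝 0) := by
  obtain ⟨C₁, h⟩ := exists_reducedSystem hn hG hM hT hC hV hH
  have hd := h.dim_mul_pos
  have hvle : ∀ t ∈ Ici M.t₀, M.V (M.φ t) ≤ M.dim * (M.dim - 1) * M.H t ^ 2 := fun t ht => by
    linarith [h.constraint t ht, h.q_nonneg t ht, h.R_nonpos t ht, h.r_nonneg t ht,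
      sq_nonneg (M.φdot t), h.v_pos t ht]
  have main : Tendsto (fun t => M.φdot t / M.H t) atTop (𝓝 0) ∧
      Tendsto (fun t => (M.shearSq t - M.spatialCurv t + 2 * (M.C (M.φ t) * M.ρ t)) / M.H t ^ 2)
        atTop (𝓝 0) := by
    obtain ⟨L, hL, hHL, hLH⟩ := h.exists_limit
    rcases hL.eq_or_lt with rfl | hL
    · have hv0 : Tendsto (fun t => M.V (M.φ t)) atTop (𝓝 0) := by
        refine squeeze_zero' ?_ ((eventually_ge_atTop M.t₀).mono hvle)
          (by simpa using (hHL.pow 2).const_mul (M.dim * (M.dim - 1)))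
        exact (eventually_ge_atTop M.t₀).mono fun t ht => (h.v_pos t ht).le
      have h1 := tendsto_φ_atTop (tendsto_abs_φ_of_tendsto_V hV hv0) (hφ (V₀_eq_zero hV hv0))
      refine h.tendsto_of_zero_limit hHL (hflat.comp (tendsto_inf.mpr ⟨h1, ?_⟩))
      exact tendsto_principal.mpr ((eventually_ge_atTop M.t₀).mono fun t ht => M.φ_mem t ht)
    · have hb : Bornology.IsBounded (M.V '' (M.φ '' M.I)) := by
        refine (Metric.isBounded_Icc 0 (M.dim * (M.dim - 1) * M.H M.t₀ ^ 2)).subset ?_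
        rintro _ ⟨_, ⟨t, ht, rfl⟩, rfl⟩
        refine ⟨(h.v_pos t ht).le, (hvle t ht).trans ?_⟩
        exact mul_le_mul_of_nonneg_left (pow_le_pow_left₀ (h.H_pos t ht).le
          (h.antitoneOn_H self_mem_Ici ht ht) 2) hd.le
      obtain ⟨W, hW⟩ := (hV.deriv_bounded _ (by rintro _ ⟨t, ht, rfl⟩; exact M.φ_mem t ht)
        hb).exists_norm_le
      exact h.tendsto_of_pos_limit hL hHL hLH fun t ht => hW _ ⟨_, ⟨t, ht, rfl⟩, rfl⟩
  obtain ⟨hp, hZ⟩ := main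
  -- The last six limits all follow by domination by a multiple of the excess Z.
  have squeeze : ∀ (f : ℝ → ℝ) (K : ℝ), (∀ t ∈ Ici M.t₀, |f t| ≤
      K * (M.shearSq t - M.spatialCurv t + 2 * (M.C (M.φ t) * M.ρ t))) →
      Tendsto (fun t => f t / M.H t ^ 2) atTop (𝓝 0) := by
    intro f K hf
    refine squeeze_zero_norm' ?_ (by simpa using hZ.const_mul K)
    filter_upwards [eventually_ge_atTop M.t₀] with t ht
    rw [Real.norm_eq_abs, abs_div, abs_of_nonneg (sq_nonneg (M.H t)), ← mul_div_assoc]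
    exact div_le_div_of_nonneg_right (hf t ht) (sq_nonneg _)
  refine ⟨h.H_pos, hp, squeeze _ 1 fun t ht => ?_, squeeze _ 1 fun t ht => ?_,
    squeeze _ 1 fun t ht => ?_, squeeze _ 1 fun t ht => ?_, squeeze _ M.dim fun t ht => ?_,
    squeeze _ C₁ fun t ht => ?_⟩ <;>
  have hq := h.q_nonneg t ht <;> have hR := h.R_nonpos t ht <;> have hr := h.r_nonneg t ht
  · rw [abs_of_nonneg hq]
    linarith
  · rw [abs_of_nonpos hR]
    linarith
  · rw [abs_of_nonneg hr]
    linarith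
  · have hC0 := hC.nonneg _ (M.φ_mem t ht)
    rw [abs_of_nonneg (mul_nonneg hC0 (show 0 ≤ M.jNorm t from Real.sqrt_nonneg _))]
    linarith [mul_le_mul_of_nonneg_left (hT.dec_flow t ht) hC0]
  · refine (h.s_le t ht).trans (mul_le_mul_of_nonneg_left ?_ (by linarith [h.dim]))
    linarith
  · refine (h.e_le t ht).trans (mul_le_mul_of_nonneg_left ?_ h.C₁_nonneg)
    linarith

end Model

theorem finrank_groupLieAlgebra {n : ℕ} {G : Type*} [TopologicalSpace G]
    [ChartedSpace (EuclideanSpace ℝ (Fin n)) G] [Group G] :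
    Module.finrank ℝ (GroupLieAlgebra (𝓡 n) G) = n :=
  (finrank_euclideanSpace_fin : Module.finrank ℝ (EuclideanSpace ℝ (Fin n)) = n)

end CoupledQuintessence

theorem mainTheorem5 {n : ℕ} (hn : 3 ≤ n)
    {G : Type*} [TopologicalSpace G] [ChartedSpace (EuclideanSpace ℝ (Fin n)) G] [Group G]
    [LieGroup (𝓡 n) (minSmoothness ℝ 3) G]
    (M : CoupledQuintessence.Model (GroupLieAlgebra (𝓡 n) G))
    (hG : ∀ h : LinearMap.BilinForm ℝ (GroupLieAlgebra (𝓡 n) G),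
      CoupledQuintessence.IsRiemannian h → CoupledQuintessence.groupScalarCurv h ≤ 0)
    (hESM : M.SolvesESM)
    (hT : M.EnergyConditions)
    (hC : M.CouplingConditions)
    (hV : M.PotentialConditions)
    (hH : 0 < M.H M.t₀)
    (hφ : M.V₀ = 0 → ¬ Tendsto M.φ atTop atBot)
    (hflat : M.FlatAtInfinity) :
    (∀ t, M.t₀ ≤ t → 0 < M.H t) ∧
    Tendsto (fun t => M.φdot t / M.H t) atTop (𝓝 0) ∧
    Tendsto (fun t => M.shearSq t / M.H t ^ 2) atTop (𝓝 0) ∧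
    Tendsto (fun t => M.spatialCurv t / M.H t ^ 2) atTop (𝓝 0) ∧
    Tendsto (fun t => M.C (M.φ t) * M.ρ t / M.H t ^ 2) atTop (𝓝 0) ∧
    Tendsto (fun t => M.C (M.φ t) * M.jNorm t / M.H t ^ 2) atTop (𝓝 0) ∧
    Tendsto (fun t => M.C (M.φ t) * M.trS t / M.H t ^ 2) atTop (𝓝 0) ∧
    Tendsto (fun t => M.c (M.φ t) * M.trT t / M.H t ^ 2) atTop (𝓝 0) :=
  CoupledQuintessence.Model.late_time_asymptotics
    (by rw [CoupledQuintessence.finrank_groupLieAlgebra]; exact hn) hG hESM hT hC hV hH hφ hflat
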